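/- **Setting.** All quantum systems are finite-dimensional. A resource theory specifies, for every system, a set of free states and a set of free unitaries. A resource measure $M$ assigns a real number to every state of every system and satisfies: (i) $M$ is non-increasing under every combination of adding a free state, performing $\mathrm{id}\otimes\mathcal E$ with $\mathcal E$ a free unitary operation or its dual, and partial traces; (ii) $M(\rho\otimes\sigma)=M(\rho)+M(\sigma)$ for all states $\rho,\sigma$; (iii) there are a real function $c$ with $\lim_{x\to0}c(x)=0$ and $c\le c_{\max}$ and, for every system $S$, constants $K_S\ge0$, $0<a_S\le\infty$, $0<b_S<\infty$ with $a_S+b_S>1$ such that $|M(\rho^{\otimes m})-M(\sigma_m)|\le m^{a_S}K_S\|\rho^{\otimes m}-\sigma_m\|_1^{b_S}+c(\|\rho^{\otimes m}-\sigma_m\|_1)$ for all $m\ge1$, all states $\rho$ on $S$ and all states $\sigma_m$ on $m$ copies of $S$; here $a_S=\infty$ means that $m^{a_S}$ is replaced by $e^{a'_Sm}$ for some real $a'_S$. For a state $\rho$ and a channel $\Gamma$ put $M_\rho(\Gamma)=M(\Gamma(\rho))-M(\rho)$ and $M(\Gamma)=\sup_{R,\sigma}M_\sigma(\mathrm{id}_R\otimes\Gamma)\in(-\infty,\infty]$,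 the supremum being over all reference systems $R$ and all joint states $\sigma$. For a channel $\Lambda$ from $A$ to $A'$, the zero-error implementation cost $M_c(\Lambda)$ is the infimum of $M(\eta)$ over all ancillary systems $B$, states $\eta$ on $B$, regroupings $AB=A'B'$ and free unitaries $U$ on $AB$ with $\Lambda(\cdot)=\mathrm{Tr}_{B'}[U(\cdot\otimes\eta)U^\dagger]$ ($+\infty$ if there are none). A two-level register $\mathscr K=(K,\{|k\rangle\}_{k=1,2})$ is a two-level system $K$ with an orthonormal basis. For states $\rho_1,\rho_2$ on $A$ with prior probabilities $p_1=p$, $p_2=1-p$, the quantity $M_{\mathrm{em}}(\Omega_p|\mathscr K)$ is the maximum of $M_\rho(\Lambda_{\mathbb P})$ over all states $\rho$ on $A$ and all two-valued projective measurements $\mathbb P=\{P_k\}$ on $A$ that discriminate $\rho_1$ and $\rho_2$ with probability one and satisfy $\Lambda_{\mathbb P}(\rho)=\sum_kp_k\rho_k\otimes|k\rangle\langle k|_K$, where $\Lambda_{\mathbb P}(\cdot)=\sum_kP_k\cdot P_k\otimes|k\rangle\langle k|_K$. **Theorem.** Let $A,A'$ be quantum systems, $\Lambda$ a channel from $A$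 to $A'$, $\rho_1,\rho_2$ orthogonal states on $A$ (i.e. with fidelity $F(\rho_1,\rho_2)=0$) with prior probabilities $p,1-p$ where $0\le p\le1$, $\mathscr K$ a two-level register, $M$ a resource measure satisfying (i)–(iii), and $\mathbb Q=\{Q_1,Q_2\}$ any two-valued POVM on $A'$ with measurement channel $\Lambda_{\mathbb Q}(\cdot)=\sum_k\sqrt{Q_k}\cdot\sqrt{Q_k}\otimes|k\rangle\langle k|_K$. Put $$\alpha=\big|M_{\mathrm{em}}(\Omega_p|\mathscr K)-M(\Lambda_{\mathbb Q})\big|_+,\qquad P_{\mathrm{fail}}=\sum_kp_k\mathrm{Tr}[(1-Q_k)\Lambda(\rho_k)],\qquad f(x)=4x+x^2,$$ where $|x|_+=\max\{x,0\}$, and let $K_{AK},a,a',b$ be constants for which (iii) holds for the system $S=AK$. Then: 1. If $a<\infty$, then $$M_c(\Lambda)\ \ge\ g(a,b)\,\frac{\alpha^{\frac{a+b}{a+b-1}}}{\big(K_{AK}\,f(\sqrt{P_{\mathrm{fail}}})^{b}\big)^{\frac1{a+b-1}}}-\alpha-c_{\max},\qquad g(a,b)=\Big(\tfrac1{a+b}\Big)^{\frac1{a+b-1}}\Big(1-\tfrac1{a+b}\Big).$$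 2. If $a=\infty$ and $a'+b>0$, then $$M_c(\Lambda)\ \ge\ \frac{\alpha}{a'+b}\log\frac{\alpha}{K_{AK}\,f(\sqrt{P_{\mathrm{fail}}})^{b}(a'+b)}-\alpha\Big(1+\frac1{a'+b}\Big)-c_{\max}.$$ 3. If $a=b=1$, then $$M_c(\Lambda)\ \ge\ \frac{\alpha^2}{16\,K_{AK}\sqrt{P_{\mathrm{fail}}}}-c_2',\qquad c_2'=c_{\max}+\alpha+\frac{\alpha^2}{64\,K_{AK}}.$$ A quotient with denominator $0$ is read as $+\infty$ if $\alpha>0$ and as $0$ if $\alpha=0$ (so $M_c(\Lambda)=\infty$ in 1 and 2 when $\alpha>0$ and the denominator vanishes; 3 has content for $K_{AK}>0$), and $0\log0=0$. No condition is imposed on the sign of $M_{\mathrm{em}}-M_{\mathrm{cos}}$, where $M_{\mathrm{cos}}$ is the minimum of $M(\Lambda_{\mathbb Q})$ over the POVMs $\mathbb Q$ that minimize $P_{\mathrm{fail}}$. -/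

import Mathlib

open scoped ComplexOrder MatrixOrder Kronecker Topology ENNReal

universe u

namespace QRT

noncomputable section

/-! Finite-dimensional quantum mechanics on index types: operators are complex matrices. -/

section Matrices

variable {a b r : Type} [Fintype a] [DecidableEq a] [Fintype b] [DecidableEq b]
  [Fintype r] [DecidableEq r]

/-- Density matrices. -/
def IsState (ρ : Matrix a a ℂ) : Prop := ρ.PosSemidef ∧ ρ.trace = 1

/-- Trace norm `‖X‖₁ = Tr √(X† X)`. -/
def traceNorm (X : Matrix a a ℂ) : ℝ := (CFC.sqrt (X.conjTranspose * X)).trace.re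

/-- Fidelity `F(ρ, σ) = Tr √(√ρ σ √ρ)`. -/
def fidelity (ρ σ : Matrix a a ℂ) : ℝ :=
  (CFC.sqrt (CFC.sqrt ρ * σ * CFC.sqrt ρ)).trace.re

/-- Purified distance `D_F(ρ, σ) = √(1 - F(ρ, σ)²)`. -/
def purifiedDist (ρ σ : Matrix a a ℂ) : ℝ := Real.sqrt (1 - fidelity ρ σ ^ 2)

/-- Partial trace over the second tensor factor. -/
def partialTrace (X : Matrix (a × b) (a × b) ℂ) : Matrix a a ℂ :=
  Matrix.of fun i j => ∑ k, X (i, k) (j, k)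

/-- `id_R ⊗ Γ`, the reference `R` being the first tensor factor. -/
def idTensor (r : Type) (Γ : Matrix a a ℂ → Matrix b b ℂ)
    (X : Matrix (r × a) (r × a) ℂ) : Matrix (r × b) (r × b) ℂ :=
  Matrix.of fun i j => Γ (Matrix.of fun k l => X (i.1, k) (j.1, l)) i.2 j.2

/-- Quantum channels: completely positive trace-preserving linear maps. -/
def IsChannel (Λ : Matrix a a ℂ →ₗ[ℂ] Matrix b b ℂ) : Prop :=
  (∀ (n : ℕ) (X : Matrix (Fin n × a) (Fin n × a) ℂ), X.PosSemidef →
    (idTensor (Fin n) Λ X).PosSemidef) ∧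
  ∀ X, (Λ X).trace = X.trace

/-- `Λ₁ ∼_ε Λ₂`: the channel purified distance, a maximum over all states on the input together
with an arbitrary finite-dimensional reference, is at most `ε`. -/
def ChannelClose (ε : ℝ) (Λ₁ Λ₂ : Matrix a a ℂ → Matrix b b ℂ) : Prop :=
  ∀ (n : ℕ) (ρ : Matrix (Fin n × a) (Fin n × a) ℂ), IsState ρ →
    purifiedDist (idTensor (Fin n) Λ₁ ρ) (idTensor (Fin n) Λ₂ ρ) ≤ ε

/-- Two-valued POVMs. -/
def IsPOVM (Q : Fin 2 → Matrix a a ℂ) : Prop := (∀ k, (Q k).PosSemidef) ∧ ∑ k, Q k = 1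

/-- Two-valued PVMs. -/
def IsPVM (P : Fin 2 → Matrix a a ℂ) : Prop :=
  (∀ k, (P k).IsHermitian ∧ P k * P k = P k) ∧ ∑ k, P k = 1

/-- The probabilities `(p, 1 - p)` of the two states of an ensemble. -/
def prior (p : ℝ) : Fin 2 → ℝ := ![p, 1 - p]

/-- Failure probability `∑ₖ pₖ Tr[(1 - Qₖ) σₖ]` of discriminating the ensemble `(σ₁, σ₂)_p`
with `Q`. -/
def pFail (p : ℝ) (σ : Fin 2 → Matrix a a ℂ) (Q : Fin 2 → Matrix a a ℂ) : ℝ :=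
  ∑ k, prior p k * ((1 - Q k) * σ k).trace.re

/-- `|k⟩⟨k|` for a vector `|k⟩` in coordinates. -/
def ketBra (v : EuclideanSpace ℂ r) : Matrix r r ℂ :=
  Matrix.of fun i j => v i * star (v j)

/-- `X ↦ ∑ₖ Eₖ X Eₖ ⊗ |k⟩⟨k|`, the measurement channel with (Hermitian) Kraus operators `Eₖ`
that stores its outcome in the register with orthonormal basis `|k⟩`. -/
def measure (κ : OrthonormalBasis (Fin 2) ℂ (EuclideanSpace ℂ r)) (E : Fin 2 → Matrix a a ℂ)
    (X : Matrix a a ℂ) : Matrix (a × r) (a × r) ℂ :=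
  ∑ k, (E k * X * E k) ⊗ₖ ketBra (κ k)

/-- `Λ_P(X) = ∑ₖ Pₖ X Pₖ ⊗ |k⟩⟨k|`. -/
def measPVM (κ : OrthonormalBasis (Fin 2) ℂ (EuclideanSpace ℂ r)) (P : Fin 2 → Matrix a a ℂ) :
    Matrix a a ℂ → Matrix (a × r) (a × r) ℂ :=
  measure κ P

/-- `Λ_Q(X) = ∑ₖ √Qₖ X √Qₖ ⊗ |k⟩⟨k|`. -/
def measPOVM (κ : OrthonormalBasis (Fin 2) ℂ (EuclideanSpace ℂ r)) (Q : Fin 2 → Matrix a a ℂ) :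
    Matrix a a ℂ → Matrix (a × r) (a × r) ℂ :=
  measure κ fun k => CFC.sqrt (Q k)

end Matrices

/-! Systems.  `E` is the collection of elementary systems of the theory (which may carry further
structure: a Hamiltonian, a preferred basis, ...), the elementary system `e` having the Hilbert
space `ℂ^(ix e)`. -/

/-- Composite systems built from elementary ones; `one` is the trivial system. -/
inductive Sys (E : Type u) : Type u
  | one : Sys E
  | atom (e : E) : Sys E
  | comp (S T : Sys E) : Sys E

variable {E : Type u} (ix : E → Type)

/-- Index set of the product basis: the Hilbert space of `S` is `ℂ^(S.idx ix)`. -/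
@[reducible] def Sys.idx : Sys E → Type
  | .one => Unit
  | .atom e => ix e
  | .comp S T => Sys.idx S × Sys.idx T

instance Sys.instFintypeIdx [∀ e, Fintype (ix e)] : (S : Sys E) → Fintype (S.idx ix)
  | .one => inferInstanceAs (Fintype Unit)
  | .atom e => inferInstanceAs (Fintype (ix e))
  | .comp S T =>
    letI := Sys.instFintypeIdx S
    letI := Sys.instFintypeIdx T
    inferInstanceAs (Fintype (S.idx ix × T.idx ix))

instance Sys.instDecidableEqIdx [∀ e, DecidableEq (ix e)] : (S : Sys E) → DecidableEq (S.idx ix)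
  | .one => inferInstanceAs (DecidableEq Unit)
  | .atom e => inferInstanceAs (DecidableEq (ix e))
  | .comp S T =>
    letI := Sys.instDecidableEqIdx S
    letI := Sys.instDecidableEqIdx T
    inferInstanceAs (DecidableEq (S.idx ix × T.idx ix))

/-- Operators on the Hilbert space of `S`. -/
abbrev Op (S : Sys E) : Type := Matrix (S.idx ix) (S.idx ix) ℂ

/-- `m` copies `S₁ ⋯ S_m` of `S`. -/
def Sys.copies (S : Sys E) : ℕ → Sys E
  | 0 => .one
  | m + 1 => .comp (Sys.copies S m) S

/-- `ρ^{⊗ m}`. -/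
def tensorPow {S : Sys E} (ρ : Op ix S) : (m : ℕ) → Op ix (S.copies m)
  | 0 => (1 : Matrix Unit Unit ℂ)
  | m + 1 => Matrix.kroneckerMap (· * ·) (tensorPow ρ m) ρ

/-- `Regroup S T e`: `S` and `T` are two ways of grouping and ordering the same constituents (such
as `A B = A' B'`), and `e` is the corresponding identification of the product bases. -/
inductive Regroup : (S T : Sys E) → (S.idx ix ≃ T.idx ix) → Prop
  | refl (S : Sys E) : Regroup S S (Equiv.refl _)
  | symm {S T : Sys E} {e : S.idx ix ≃ T.idx ix} : Regroup S T e → Regroup T S e.symm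
  | trans {S T V : Sys E} {e : S.idx ix ≃ T.idx ix} {f : T.idx ix ≃ V.idx ix} :
      Regroup S T e → Regroup T V f → Regroup S V (e.trans f)
  | congr {S S' T T' : Sys E} {e : S.idx ix ≃ S'.idx ix} {f : T.idx ix ≃ T'.idx ix} :
      Regroup S S' e → Regroup T T' f →
        Regroup (.comp S T) (.comp S' T') (Equiv.prodCongr e f)
  | assoc (S T V : Sys E) :
      Regroup (.comp (.comp S T) V) (.comp S (.comp T V)) (Equiv.prodAssoc _ _ _)
  | swap (S T : Sys E) : Regroup (.comp S T) (.comp T S) (Equiv.prodComm _ _)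
  | unit (S : Sys E) : Regroup (.comp S .one) S (Equiv.prodPUnit _)

variable [∀ e, Fintype (ix e)] [∀ e, DecidableEq (ix e)]

/-- The data of a resource theory that matter here: for every system, the set of free states and
the set of free unitaries. -/
structure ResourceTheory where
  freeStates : (S : Sys E) → Set (Op ix S)
  isState_of_free : ∀ (S : Sys E) (τ : Op ix S), τ ∈ freeStates S → IsState τ
  freeUnitaries : (S : Sys E) → Set (Matrix.unitaryGroup (S.idx ix) ℂ)

variable {ix}

/-- Combinations of (a) adding a free state, (b) performing `id ⊗ 𝓔` with `𝓔` a free unitary or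
its dual, (c) partial traces.  `regroup` does nothing physically: it re-expresses the operator of
a composite system in another grouping of its constituents, so that (a), (b) and (c) can act on any
of them. -/
inductive FreeOp (T : ResourceTheory ix) : (S S' : Sys E) → (Op ix S → Op ix S') → Prop
  | regroup {S S' : Sys E} {e : S.idx ix ≃ S'.idx ix} :
      Regroup ix S S' e → FreeOp T S S' (fun X => Matrix.reindex e e X)
  | addFree (S F : Sys E) (τ : Op ix F) : τ ∈ T.freeStates F →
      FreeOp T S (.comp S F) (fun X => Matrix.kroneckerMap (· * ·) X τ)
  | unitary (R S : Sys E) (U : Matrix.unitaryGroup (S.idx ix) ℂ) : U ∈ T.freeUnitaries S →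
      FreeOp T (.comp R S) (.comp R S) (idTensor (R.idx ix)
        fun X => (U : Op ix S) * X * (U : Op ix S).conjTranspose)
  | dual (R S : Sys E) (U : Matrix.unitaryGroup (S.idx ix) ℂ) : U ∈ T.freeUnitaries S →
      FreeOp T (.comp R S) (.comp R S) (idTensor (R.idx ix)
        fun X => (U : Op ix S).conjTranspose * X * (U : Op ix S))
  | trace (S S' : Sys E) : FreeOp T (.comp S S') S partialTrace
  | comp {S S' S'' : Sys E} {Φ : Op ix S → Op ix S'} {Ψ : Op ix S' → Op ix S''} :
      FreeOp T S S' Φ → FreeOp T S' S'' Ψ → FreeOp T S S'' (Ψ ∘ Φ)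

/-- A real-valued function of the states of all systems (only its values on states matter). -/
abbrev StateFunction (ix : E → Type) : Type u := (S : Sys E) → Op ix S → ℝ

/-- Hölder continuity of `M` on the copies of `S`, with constants `κ`, `a`, `b`, `a < ∞`. -/
structure HolderFinite (M : StateFunction ix) (c : ℝ → ℝ) (S : Sys E) (κ a b : ℝ) : Prop where
  κ_nonneg : 0 ≤ κ
  a_pos : 0 < a
  b_pos : 0 < b
  one_lt : 1 < a + b
  bound : ∀ m : ℕ, 1 ≤ m → ∀ ρ : Op ix S, IsState ρ → ∀ σ : Op ix (S.copies m), IsState σ →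
    |M (S.copies m) (tensorPow ix ρ m) - M (S.copies m) σ| ≤
      (m : ℝ) ^ a * κ * traceNorm (tensorPow ix ρ m - σ) ^ b +
        c (traceNorm (tensorPow ix ρ m - σ))

/-- The same for `a = ∞`: the factor `m ^ a` is replaced by `exp (a' m)`. -/
structure HolderInfinite (M : StateFunction ix) (c : ℝ → ℝ) (S : Sys E) (κ a' b : ℝ) : Prop where
  κ_nonneg : 0 ≤ κ
  b_pos : 0 < b
  bound : ∀ m : ℕ, 1 ≤ m → ∀ ρ : Op ix S, IsState ρ → ∀ σ : Op ix (S.copies m), IsState σ →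
    |M (S.copies m) (tensorPow ix ρ m) - M (S.copies m) σ| ≤
      Real.exp (a' * m) * κ * traceNorm (tensorPow ix ρ m - σ) ^ b +
        c (traceNorm (tensorPow ix ρ m - σ))

/-- Resource measures: (i) monotonicity, (ii) additivity on product states, (iii) Hölder continuity
with remainder `c`, bounded by `cmax`. -/
structure IsResourceMeasure (T : ResourceTheory ix) (M : StateFunction ix) (c : ℝ → ℝ) (cmax : ℝ) :
    Prop where
  monotone : ∀ (S S' : Sys E) (Φ : Op ix S → Op ix S'), FreeOp T S S' Φ →
    ∀ ρ : Op ix S, IsState ρ → M S' (Φ ρ) ≤ M S ρ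
  additive : ∀ (S S' : Sys E) (ρ : Op ix S) (σ : Op ix S'), IsState ρ → IsState σ →
    M (.comp S S') (Matrix.kroneckerMap (· * ·) ρ σ) = M S ρ + M S' σ
  c_tendsto : Filter.Tendsto c (𝓝[>] 0) (𝓝 0)
  c_le : ∀ x, 0 ≤ x → c x ≤ cmax
  holder : ∀ S : Sys E,
    (∃ κ a b, HolderFinite M c S κ a b) ∨ (∃ κ a' b, HolderInfinite M c S κ a' b)

/-- Resource gain `M_ρ(Γ) = M(Γ(ρ)) - M(ρ)`. -/
def gain (M : StateFunction ix) {S S' : Sys E} (Γ : Op ix S → Op ix S') (ρ : Op ix S) : ℝ :=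
  M S' (Γ ρ) - M S ρ

/-- Resource-increasing power `M(Γ) = sup_{R, σ} M_σ(id_R ⊗ Γ)`, possibly `+∞`. -/
def power (M : StateFunction ix) {S S' : Sys E} (Γ : Op ix S → Op ix S') : EReal :=
  sSup {x | ∃ (R : Sys E) (σ : Op ix (.comp R S)), IsState σ ∧
    x = ((gain M (S := .comp R S) (S' := .comp R S') (idTensor (R.idx ix) Γ) σ : ℝ) : EReal)}

/-- The channel `X ↦ Tr_{B'}[U (X ⊗ η) U†]` from `A` to `A'`, where `e` identifies
`A B = A' B'`. -/
def implemented {A A' B B' : Sys E}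
    (e : (Sys.comp A B).idx ix ≃ (Sys.comp A' B').idx ix)
    (U : Matrix.unitaryGroup ((Sys.comp A B).idx ix) ℂ) (η : Op ix B) (X : Op ix A) : Op ix A' :=
  partialTrace (Matrix.reindex e e
    ((U : Op ix (Sys.comp A B)) * (Matrix.kroneckerMap (· * ·) X η : Op ix (Sys.comp A B)) *
      (U : Op ix (Sys.comp A B)).conjTranspose))

/-- Implementation cost `M_c^ε(Λ)`: the infimum of `M(η)` over all implementations of `Λ` with
error `ε` by a free unitary, `+∞` if there is none. -/
def cost (T : ResourceTheory ix) (M : StateFunction ix) (ε : ℝ) {A A' : Sys E}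
    (Λ : Op ix A → Op ix A') : EReal :=
  sInf {x | ∃ (B B' : Sys E) (e : (Sys.comp A B).idx ix ≃ (Sys.comp A' B').idx ix)
    (U : Matrix.unitaryGroup ((Sys.comp A B).idx ix) ℂ) (η : Op ix B),
    Regroup ix (.comp A B) (.comp A' B') e ∧ U ∈ T.freeUnitaries (.comp A B) ∧ IsState η ∧
      ChannelClose ε Λ (implemented e U η) ∧ x = ((M B η : ℝ) : EReal)}

/-- Resource gain `M_em(Ω_p | 𝒦)` by discriminating the ensemble `(ρ₁, ρ₂)_p` on `A`: the maximum
of `M_ρ(Λ_P)` over the states `ρ` and the PVMs `P` that discriminate `ρ₁` and `ρ₂` with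
probability one and satisfy `Λ_P(ρ) = ∑ₖ pₖ ρₖ ⊗ |k⟩⟨k|`. -/
def emGain (M : StateFunction ix) {A K : Sys E}
    (κ : OrthonormalBasis (Fin 2) ℂ (EuclideanSpace ℂ (K.idx ix))) (p : ℝ)
    (Ω : Fin 2 → Op ix A) : EReal :=
  sSup {x | ∃ (ρ : Op ix A) (P : Fin 2 → Op ix A), IsState ρ ∧ IsPVM P ∧
    (∀ k, (P k * Ω k).trace = 1) ∧
    measPVM κ P ρ = ∑ k, ((prior p k : ℝ) : ℂ) • (Ω k ⊗ₖ ketBra (κ k)) ∧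
    x = ((gain M (S := A) (S' := .comp A K) (measPVM κ P) ρ : ℝ) : EReal)}

/-- `f(x) = 4x + x²`. -/
def fErr (x : ℝ) : ℝ := 4 * x + x ^ 2

/-- `g(a, b) = (1/(a+b))^{1/(a+b-1)} (1 - 1/(a+b))`. -/
def gConst (a b : ℝ) : ℝ := (1 / (a + b)) ^ (1 / (a + b - 1)) * (1 - 1 / (a + b))

end

end QRT

open QRT

/-! The ancilla of an implementation can be reused. Let η and U implement Λ exactly. One round
adjoins a fresh state ρ on A, applies U, measures Q on A', keeps the outcome in K and applies U†. On
AB this is a measurement with Kraus operators F_k = U†(√Q_k ⊗ 1)U. If the states Λ(ρ_k) are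
discriminated well by Q, then F_k acts on ρ ⊗ η almost like P_k ⊗ 1, which would turn ρ into Λ_P(ρ)
and return η intact. The disturbance is at most 4√P_fail in trace norm (a limit of
`diffBound_measure_sub`), and the errors of successive rounds add up (`diffBound_reuseState`). So m
rounds produce a state within 4m√P_fail of Λ_P(ρ)^{⊗m}.

In a round, U, U† and all regroupings do not raise M; only the fresh ρ and the measurement of Q
contribute, the latter at most M(Λ_Q) (`resource_reuse_le`). Hence the output of m rounds has
resource at most M(η) + m(M(ρ) + M(Λ_Q)), whereas additivity gives the ideal output m·M(Λ_P(ρ)).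
Comparing the two by (iii) and taking the supremum over ρ and P gives, for finite a, m α ≤ M(η) +
c_max + m^{a+b} K f(√P_fail)^b for all m ≥ 1, with e^{(a'+b)m} in place of m^{a+b} when a = ∞
(`exists_alpha_le`).

It remains to choose m. The real maximizer of the resulting lower bound on M(η) gives the leading
term of each claim, and rounding it down costs at most α (`le_of_forall_nat_rpow`,
`le_of_forall_nat_exp`, `le_of_forall_nat_sq`). -/

namespace QRT

/-! ### Trace-norm bounds from differences of positive operators -/

section TraceNorm

variable {n : Type} [Fintype n]

lemma re_trace_nonneg {X : Matrix n n ℂ} (hX : X.PosSemidef) : 0 ≤ X.trace.re :=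
  (Complex.le_def.1 hX.trace_nonneg).1

lemma re_trace_mul_nonneg [DecidableEq n] {A B : Matrix n n ℂ} (hA : A.PosSemidef) (hB : B.PosSemidef) :
    0 ≤ (A * B).trace.re := by
  obtain ⟨C, rfl⟩ := CStarAlgebra.nonneg_iff_eq_star_mul_self.1 (Matrix.nonneg_iff_posSemidef.2 hB)
  rw [← mul_assoc, Matrix.trace_mul_comm, ← mul_assoc]
  exact re_trace_nonneg (hA.mul_mul_conjTranspose_same C)

/-- `X` is a difference of positive semidefinite matrices of total trace at most `t`. -/
def DiffBound (X : Matrix n n ℂ) (t : ℝ) : Prop :=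
  ∃ P N : Matrix n n ℂ, P.PosSemidef ∧ N.PosSemidef ∧ X = P - N ∧
    P.trace.re + N.trace.re ≤ t

lemma DiffBound.add {X Y : Matrix n n ℂ} {s t : ℝ} (hX : DiffBound X s) (hY : DiffBound Y t) :
    DiffBound (X + Y) (s + t) := by
  obtain ⟨P, N, hP, hN, rfl, h⟩ := hX
  obtain ⟨P', N', hP', hN', rfl, h'⟩ := hY
  refine ⟨P + P', N + N', hP.add hP', hN.add hN', by abel, ?_⟩
  simp only [Matrix.trace_add, Complex.add_re]
  linarith

lemma DiffBound.neg {X : Matrix n n ℂ} {t : ℝ} (hX : DiffBound X t) : DiffBound (-X) t := by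
  obtain ⟨P, N, hP, hN, rfl, h⟩ := hX
  exact ⟨N, P, hN, hP, neg_sub _ _, by linarith⟩

lemma DiffBound.zero : DiffBound (0 : Matrix n n ℂ) 0 :=
  ⟨0, 0, .zero, .zero, by simp, by simp⟩

variable [DecidableEq n]

lemma continuousOn_spectrum (X : Matrix n n ℂ) (f : ℝ → ℝ) :
    ContinuousOn f (spectrum ℝ X) :=
  (Matrix.finite_real_spectrum).continuousOn f

lemma cfc_mul_self {X : Matrix n n ℂ} (hX : IsSelfAdjoint X) (f : ℝ → ℝ) :
    cfc f X * X = cfc (fun x => f x * x) X := by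
  rw [cfc_mul f (fun x => x) X (continuousOn_spectrum _ _) (continuousOn_spectrum _ _),
    cfc_id' ℝ X]

lemma traceNorm_nonneg (X : Matrix n n ℂ) : 0 ≤ traceNorm X :=
  re_trace_nonneg (Matrix.nonneg_iff_posSemidef.1 (CFC.sqrt_nonneg _))

/-- With S = sgn X one has |X| = SX, so the trace norm is Tr SP − Tr SN, and −1 ≤ S ≤ 1 bounds the
two terms by Tr P and Tr N. All errors are tracked as such decompositions, for which additivity and
contraction under positive trace-preserving maps are immediate; the trace norm itself enters only at
the end. -/
lemma DiffBound.traceNorm_le {X : Matrix n n ℂ} {t : ℝ} (hX : DiffBound X t) :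
    traceNorm X ≤ t := by
  obtain ⟨P, N, hP, hN, hX, h⟩ := hX
  have hs : IsSelfAdjoint X := by
    rw [hX]
    exact (hP.isHermitian.sub hN.isHermitian)
  let S := cfc (fun x : ℝ => SignType.sign x : ℝ → ℝ) X
  have hS : CFC.abs X = S * X := by
    rw [CFC.abs_eq_cfc_norm X hs]
    rw [cfc_mul_self hs]
    refine cfc_congr fun x _ => ?_
    simp
  have h1 : (1 - S).PosSemidef := by
    rw [← Matrix.nonneg_iff_posSemidef, sub_nonneg]
    exact cfc_le_one _ _ fun x _ => by rcases lt_trichotomy x 0 with h | h | h <;> simp [h]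
  have h2 : (1 + S).PosSemidef := by
    rw [← Matrix.nonneg_iff_posSemidef, ← sub_neg_eq_add, sub_nonneg, ← cfc_neg]
    exact cfc_le_one _ _ fun x _ => by rcases lt_trichotomy x 0 with h | h | h <;> simp [h]
  have h3 : traceNorm X = (S * P).trace.re - (S * N).trace.re := by
    change (CFC.abs X).trace.re = _
    rw [hS]
    conv_lhs => rw [hX]
    rw [mul_sub, Matrix.trace_sub, Complex.sub_re]
  have h4 := re_trace_mul_nonneg h1 hP
  have h5 := re_trace_mul_nonneg h2 hN
  simp only [sub_mul, add_mul, one_mul, Matrix.trace_sub, Matrix.trace_add, Complex.sub_re,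
    Complex.add_re] at h4 h5
  linarith

end TraceNorm

/-! ### Fidelity one forces equality -/

section Fidelity

variable {n : Type} [Fintype n] [DecidableEq n]

lemma sqrt_posSemidef (X : Matrix n n ℂ) : (CFC.sqrt X).PosSemidef :=
  Matrix.nonneg_iff_posSemidef.1 (CFC.sqrt_nonneg _)

lemma sqrt_conjTranspose (X : Matrix n n ℂ) : (CFC.sqrt X).conjTranspose = CFC.sqrt X :=
  (sqrt_posSemidef X).isHermitian

lemma sqrt_mul_sqrt {X : Matrix n n ℂ} (hX : X.PosSemidef) : CFC.sqrt X * CFC.sqrt X = X :=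
  CFC.sqrt_mul_sqrt_self X (Matrix.nonneg_iff_posSemidef.2 hX)

lemma fidelity_nonneg (ρ σ : Matrix n n ℂ) : 0 ≤ fidelity ρ σ :=
  re_trace_nonneg (sqrt_posSemidef _)

/-- A contraction attaining the trace norm of `T`. -/
lemma exists_contraction (T : Matrix n n ℂ) : ∃ W : Matrix n n ℂ,
    (1 - W.conjTranspose * W).PosSemidef ∧
      (W * T).trace = (CFC.sqrt (T.conjTranspose * T)).trace := by
  set H := T.conjTranspose * T with hH
  have hpos : H.PosSemidef := Matrix.posSemidef_conjTranspose_mul_self T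
  have hs : IsSelfAdjoint H := hpos.isHermitian
  have hsp : ∀ x ∈ spectrum ℝ H, 0 ≤ x := fun x hx =>
    spectrum_nonneg_of_nonneg (Matrix.nonneg_iff_posSemidef.2 hpos) hx
  -- The pseudo-inverse of √H: since `0⁻¹ = 0`, it vanishes on the kernel. Then G T† is the adjoint
  -- of the polar partial isometry of T.
  let G := cfc (fun x : ℝ => (√x)⁻¹) H
  have hG : G.conjTranspose = G := (cfc_predicate (p := IsSelfAdjoint) (fun x : ℝ => (√x)⁻¹) H)
  have hGH : G * H = CFC.sqrt H := by
    rw [CFC.sqrt_eq_real_sqrt H (Matrix.nonneg_iff_posSemidef.2 hpos), cfcₙ_eq_cfc,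
      cfc_mul_self hs]
    · refine cfc_congr fun x hx => ?_
      have := Real.mul_self_sqrt (hsp x hx)
      by_cases h : √x = 0
      · simp [h]
      · field_simp; nlinarith
  have hGG : G * H * G * G = G := by
    rw [cfc_mul_self hs,
      ← cfc_mul _ _ _ (continuousOn_spectrum _ _) (continuousOn_spectrum _ _),
      ← cfc_mul _ _ _ (continuousOn_spectrum _ _) (continuousOn_spectrum _ _)]
    refine cfc_congr fun x hx => ?_
    have := Real.mul_self_sqrt (hsp x hx)
    by_cases h : √x = 0
    · simp [h]
    · field_simp; nlinarith
  refine ⟨G * T.conjTranspose, ?_, ?_⟩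
  · set W := G * T.conjTranspose with hW
    have hQ : W.conjTranspose * W * (W.conjTranspose * W) = W.conjTranspose * W := by
      have : W * W.conjTranspose * W = W := by
        have h1 : W * W.conjTranspose = G * H * G := by
          simp [hW, hH, hG, mul_assoc]
        rw [h1, hW, ← mul_assoc, hGG]
      rw [mul_assoc, ← mul_assoc W, this]
    have : 1 - W.conjTranspose * W
        = (1 - W.conjTranspose * W).conjTranspose * (1 - W.conjTranspose * W) := by
      simp only [Matrix.conjTranspose_sub, Matrix.conjTranspose_one, Matrix.conjTranspose_mul,
        Matrix.conjTranspose_conjTranspose, mul_sub, sub_mul, mul_one, one_mul, hQ]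
      simp
    rw [this]
    exact Matrix.posSemidef_conjTranspose_mul_self _
  · rw [mul_assoc, ← hH, hGH]

/-- For a contraction W attaining the trace norm of √σ√ρ, the squared Hilbert–Schmidt norm of √ρ −
√σW† is at most 2 − 2F ≤ 0. Hence √ρ = √σW†, so ρ ≤ σ, and equal traces force equality. This turns
zero error, defined through the purified distance, into an identity. -/
lemma eq_of_one_le_fidelity {ρ σ : Matrix n n ℂ} (hρ : IsState ρ) (hσ : IsState σ)
    (h : 1 ≤ fidelity ρ σ) : ρ = σ := by
  obtain ⟨W, hW, hT⟩ := exists_contraction (CFC.sqrt σ * CFC.sqrt ρ)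
  set r := CFC.sqrt ρ with hr
  set s := CFC.sqrt σ with hs
  have hrr : r * r = ρ := sqrt_mul_sqrt hρ.1
  have hss : s * s = σ := sqrt_mul_sqrt hσ.1
  have hrh : r.conjTranspose = r := sqrt_conjTranspose ρ
  have hsh : s.conjTranspose = s := sqrt_conjTranspose σ
  have hF : (W * (s * r)).trace.re = fidelity ρ σ := by
    rw [hT, fidelity, ← hr, Matrix.conjTranspose_mul, hrh, hsh, ← hss]
    simp only [mul_assoc]
  have hgap : (σ - s * (W.conjTranspose * W) * s).PosSemidef := by
    have := hW.mul_mul_conjTranspose_same s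
    rwa [hsh, mul_sub, sub_mul, mul_one, hss] at this
  have hD : (r - s * W.conjTranspose).conjTranspose * (r - s * W.conjTranspose) = 0 := by
    have hp := Matrix.posSemidef_conjTranspose_mul_self (r - s * W.conjTranspose)
    rw [← hp.trace_eq_zero_iff]
    have h0 := re_trace_nonneg hp
    have h1 : ((r - s * W.conjTranspose).conjTranspose * (r - s * W.conjTranspose)).trace.re
        = 1 - 2 * fidelity ρ σ + (s * (W.conjTranspose * W) * s).trace.re := by
      have e1 : (r - s * W.conjTranspose).conjTranspose * (r - s * W.conjTranspose)
          = ρ - W * (s * r) - (W * (s * r)).conjTranspose + W * (s * s) * W.conjTranspose := by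
        simp only [Matrix.conjTranspose_sub, Matrix.conjTranspose_mul, hrh, hsh,
          Matrix.conjTranspose_conjTranspose, ← hrr]
        noncomm_ring
      have e2 : (W * (s * s) * W.conjTranspose).trace
          = (s * (W.conjTranspose * W) * s).trace := by
        rw [Matrix.trace_mul_cycle, Matrix.trace_mul_cycle s, Matrix.trace_mul_comm]
      rw [e1, Matrix.trace_add, Matrix.trace_sub, Matrix.trace_sub, Matrix.trace_conjTranspose,
        e2, hρ.2, ← hF]
      simp
      ring
    have h2 := re_trace_nonneg hgap
    rw [Matrix.trace_sub, hσ.2] at h2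
    simp only [Complex.sub_re, Complex.one_re] at h2
    refine Complex.ext ?_ ?_
    · simp only [Complex.zero_re]; linarith
    · exact (Complex.le_def.1 hp.trace_nonneg).2.symm
  have hD' : r = s * W.conjTranspose :=
    sub_eq_zero.1 (Matrix.conjTranspose_mul_self_eq_zero.1 hD)
  have hρ' : ρ = s * (W.conjTranspose * W) * s := by
    have : ρ = r * r.conjTranspose := by rw [hrh, hrr]
    rw [this, hD', Matrix.conjTranspose_mul, hsh, Matrix.conjTranspose_conjTranspose]
    simp only [mul_assoc]
  rw [← hρ'] at hgap
  have := hgap.trace_eq_zero_iff.1 (by rw [Matrix.trace_sub, hρ.2, hσ.2, sub_self])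
  exact (sub_eq_zero.1 this).symm

end Fidelity

/-! ### Positive trace-preserving maps -/

section PositiveMaps

variable {l m n : Type} [Fintype l] [Fintype m] [Fintype n]

/-- Additive, positive and trace-preserving maps. -/
structure PosTP (Φ : Matrix m m ℂ → Matrix n n ℂ) : Prop where
  map_sub : ∀ X Y, Φ (X - Y) = Φ X - Φ Y
  posSemidef : ∀ X, X.PosSemidef → (Φ X).PosSemidef
  trace : ∀ X, (Φ X).trace = X.trace

lemma PosTP.comp {Ψ : Matrix m m ℂ → Matrix n n ℂ} {Φ : Matrix l l ℂ → Matrix m m ℂ}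
    (hΨ : PosTP Ψ) (hΦ : PosTP Φ) : PosTP fun X => Ψ (Φ X) where
  map_sub X Y := by rw [hΦ.map_sub, hΨ.map_sub]
  posSemidef X hX := hΨ.posSemidef _ (hΦ.posSemidef _ hX)
  trace X := by rw [hΨ.trace, hΦ.trace]

lemma PosTP.isState {Φ : Matrix m m ℂ → Matrix n n ℂ} (hΦ : PosTP Φ) {ρ : Matrix m m ℂ}
    (hρ : IsState ρ) : IsState (Φ ρ) :=
  ⟨hΦ.posSemidef _ hρ.1, by rw [hΦ.trace, hρ.2]⟩

lemma PosTP.diffBound {Φ : Matrix m m ℂ → Matrix n n ℂ} (hΦ : PosTP Φ) {X : Matrix m m ℂ}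
    {t : ℝ} (hX : DiffBound X t) : DiffBound (Φ X) t := by
  obtain ⟨P, N, hP, hN, rfl, h⟩ := hX
  exact ⟨Φ P, Φ N, hΦ.posSemidef _ hP, hΦ.posSemidef _ hN, hΦ.map_sub _ _,
    by rwa [hΦ.trace, hΦ.trace]⟩

lemma posTP_reindex (e : m ≃ n) : PosTP fun X : Matrix m m ℂ => Matrix.reindex e e X where
  map_sub X Y := rfl
  posSemidef X hX := hX.submatrix _
  trace X := by
    simp only [Matrix.trace, Matrix.reindex_apply, Matrix.diag_apply, Matrix.submatrix_apply]
    exact Equiv.sum_comp e.symm fun i => X i i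

lemma posTP_kronecker_right {τ : Matrix m m ℂ} (hτ : IsState τ) :
    PosTP fun X : Matrix n n ℂ => X ⊗ₖ τ where
  map_sub X Y := by ext; simp [sub_mul]
  posSemidef X hX := hX.kronecker hτ.1
  trace X := by rw [Matrix.trace_kronecker, hτ.2, mul_one]

lemma posTP_kronecker_left {τ : Matrix m m ℂ} (hτ : IsState τ) :
    PosTP fun X : Matrix n n ℂ => τ ⊗ₖ X where
  map_sub X Y := by ext; simp [mul_sub]
  posSemidef X hX := hτ.1.kronecker hX
  trace X := by rw [Matrix.trace_kronecker, hτ.2, one_mul]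

lemma isState_kronecker {ρ : Matrix m m ℂ} {σ : Matrix n n ℂ} (hρ : IsState ρ)
    (hσ : IsState σ) : IsState (ρ ⊗ₖ σ) :=
  (posTP_kronecker_right hσ).isState hρ

lemma posTP_conj [DecidableEq m] {V : Matrix n m ℂ} (hV : V.conjTranspose * V = 1) :
    PosTP fun X : Matrix m m ℂ => V * X * V.conjTranspose where
  map_sub X Y := by rw [Matrix.mul_sub, Matrix.sub_mul]
  posSemidef X hX := hX.mul_mul_conjTranspose_same V
  trace X := by rw [Matrix.trace_mul_cycle, hV, Matrix.one_mul]

lemma posTP_partialTrace : PosTP (partialTrace : Matrix (m × n) (m × n) ℂ → Matrix m m ℂ) where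
  map_sub X Y := by ext; simp [partialTrace]
  posSemidef X hX := by
    have : partialTrace X = ∑ k, X.submatrix (fun i => (i, k)) (fun i => (i, k)) := by
      ext; simp [partialTrace, Matrix.sum_apply]
    rw [this]
    exact Matrix.posSemidef_sum _ fun k _ => hX.submatrix _
  trace X := by simp [partialTrace, Matrix.trace, Fintype.sum_prod_type]

lemma partialTrace_kronecker {m n : Type} [Fintype n] {X : Matrix m m ℂ} {τ : Matrix n n ℂ}
    (hτ : IsState τ) : partialTrace (X ⊗ₖ τ) = X := by
  ext i j
  simp only [partialTrace, Matrix.of_apply, Matrix.kroneckerMap_apply, ← Finset.mul_sum]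
  have : ∑ k, τ k k = 1 := hτ.2
  rw [this, mul_one]

end PositiveMaps

/-! ### Measurement channels with a register, and their extension by a reference -/

lemma one_kronecker_isHermitian {a c : Type} [DecidableEq c] {F : Matrix a a ℂ} (hF : F.IsHermitian) :
    ((1 : Matrix c c ℂ) ⊗ₖ F).IsHermitian := by
  rw [Matrix.IsHermitian, Matrix.conjTranspose_kronecker, Matrix.conjTranspose_one, hF.eq]

/-- The blocks of an operator that is block diagonal with respect to the register basis. -/
lemma sum_kronecker_ketBra_injective {a r : Type} [Fintype r]
    (κ : OrthonormalBasis (Fin 2) ℂ (EuclideanSpace ℂ r)) {X Y : Fin 2 → Matrix a a ℂ} (h : ∑ k, X k ⊗ₖ ketBra (κ k) = ∑ k, Y k ⊗ₖ ketBra (κ k))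
    (k : Fin 2) : X k = Y k := by
  -- Sandwiching the register between ⟨k| and |k⟩ extracts the k-th block.
  have key : ∀ (Z : Fin 2 → Matrix a a ℂ) (i j : a),
      ∑ s, ∑ t, star (κ k s) * (∑ l, Z l ⊗ₖ ketBra (κ l)) (i, s) (j, t) * κ k t = Z k i j := by
    intro Z i j
    have horth : ∀ l l', ∑ s, star (κ l s) * κ l' s = if l = l' then 1 else 0 := by
      intro l l'
      rw [← orthonormal_iff_ite.1 κ.orthonormal l l', PiLp.inner_apply]
      simp [mul_comm]
    calc _ = ∑ l, Z l i j * (∑ s, star (κ k s) * κ l s) * ∑ t, star (κ l t) * κ k t := by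
          simp only [Matrix.sum_apply, Matrix.kroneckerMap_apply, ketBra, Matrix.of_apply,
            Finset.mul_sum, Finset.sum_mul]
          rw [Finset.sum_comm]
          conv_rhs => rw [Finset.sum_comm]
          refine Finset.sum_congr rfl fun t _ => ?_
          rw [Finset.sum_comm]
          refine Finset.sum_congr rfl fun l _ => Finset.sum_congr rfl fun s _ => ?_
          ring
      _ = Z k i j := by simp only [horth]; simp
  ext i j
  rw [← key X, ← key Y, h]

section Measurement

variable {a c r : Type} [Fintype a] [Fintype r]

lemma isState_ketBra (v : EuclideanSpace ℂ r) (hv : ‖v‖ = 1) : IsState (ketBra v) := by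
  constructor
  · exact Matrix.posSemidef_vecMulVec_self_star (v : r → ℂ)
  · have h := EuclideanSpace.norm_sq_eq v
    rw [hv] at h
    simp only [Matrix.trace, ketBra, Matrix.diag_apply, Matrix.of_apply]
    have : ∀ i, v i * star (v i) = ((‖v i‖ ^ 2 : ℝ) : ℂ) := fun i => by
      rw [RCLike.star_def, RCLike.mul_conj]; simp
    simp only [this]
    rw [← Complex.ofReal_sum, ← h]
    simp

lemma isState_ketBra_basis (κ : OrthonormalBasis (Fin 2) ℂ (EuclideanSpace ℂ r)) (k : Fin 2) :
    IsState (ketBra (κ k)) :=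
  isState_ketBra _ (κ.norm_eq_one k)

lemma measure_sub (κ : OrthonormalBasis (Fin 2) ℂ (EuclideanSpace ℂ r))
    (F : Fin 2 → Matrix a a ℂ) (X Y : Matrix a a ℂ) :
    measure κ F (X - Y) = measure κ F X - measure κ F Y := by
  simp only [measure, ← Finset.sum_sub_distrib]
  refine Finset.sum_congr rfl fun k _ => ?_
  rw [mul_sub, sub_mul, (posTP_kronecker_right (isState_ketBra_basis κ k)).map_sub]

lemma posTP_measure [DecidableEq a] (κ : OrthonormalBasis (Fin 2) ℂ (EuclideanSpace ℂ r))
    {F : Fin 2 → Matrix a a ℂ} (hF : ∀ k, (F k).IsHermitian) (hsum : ∑ k, F k * F k = 1) :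
    PosTP (measure κ F) where
  map_sub := measure_sub κ F
  posSemidef X hX := by
    refine Matrix.posSemidef_sum _ fun k _ =>
      Matrix.PosSemidef.kronecker ?_ (isState_ketBra_basis κ k).1
    have := hX.mul_mul_conjTranspose_same (F k)
    rwa [(hF k).eq] at this
  trace X := by
    simp only [measure, Matrix.trace_sum, Matrix.trace_kronecker, (isState_ketBra_basis κ _).2,
      mul_one]
    have : ∀ k, (F k * X * F k).trace = (F k * F k * X).trace := fun k => by
      rw [Matrix.trace_mul_cycle]
    simp only [this]
    rw [← Matrix.trace_sum, ← Finset.sum_mul, hsum, one_mul]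

lemma measure_reindex {a' : Type} [Fintype a']
    (κ : OrthonormalBasis (Fin 2) ℂ (EuclideanSpace ℂ r)) (s : a ≃ a')
    (F : Fin 2 → Matrix a a ℂ) (X : Matrix a a ℂ) :
    measure κ (fun k => Matrix.reindex s s (F k)) (Matrix.reindex s s X) =
      Matrix.reindex (s.prodCongr (Equiv.refl r)) (s.prodCongr (Equiv.refl r))
        (measure κ F X) := by
  simp only [measure, Matrix.reindex_apply, Matrix.submatrix_mul_equiv]
  ext i j
  simp [Matrix.sum_apply]

lemma measure_conj [DecidableEq r] (κ : OrthonormalBasis (Fin 2) ℂ (EuclideanSpace ℂ r))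
    (F : Fin 2 → Matrix a a ℂ) (V W X : Matrix a a ℂ) :
    measure κ (fun k => W * F k * V) X =
      (W ⊗ₖ (1 : Matrix r r ℂ)) * measure κ F (V * X * W) * (V ⊗ₖ (1 : Matrix r r ℂ)) := by
  simp only [measure, Finset.mul_sum, Finset.sum_mul, ← Matrix.mul_kronecker_mul, one_mul,
    mul_one, mul_assoc]

variable [Fintype c] [DecidableEq c]

lemma idTensor_conj (V W : Matrix a a ℂ) (X : Matrix (c × a) (c × a) ℂ) :
    idTensor c (fun Y => V * Y * W) X =
      ((1 : Matrix c c ℂ) ⊗ₖ V) * X * ((1 : Matrix c c ℂ) ⊗ₖ W) := by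
  ext ⟨i, j⟩ ⟨k, l⟩
  simp [idTensor, Matrix.mul_apply, Fintype.sum_prod_type, Matrix.one_apply,
    Finset.sum_ite_irrel]

lemma idTensor_measure (κ : OrthonormalBasis (Fin 2) ℂ (EuclideanSpace ℂ r))
    (F : Fin 2 → Matrix a a ℂ) (X : Matrix (c × a) (c × a) ℂ) :
    idTensor c (measure κ F) X =
      Matrix.reindex (Equiv.prodAssoc c a r) (Equiv.prodAssoc c a r)
        (measure κ (fun k => (1 : Matrix c c ℂ) ⊗ₖ F k) X) := by
  ext ⟨i, j, s⟩ ⟨k, l, t⟩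
  simp only [measure, ← idTensor_conj]
  simp [idTensor, measure, Matrix.sum_apply]

lemma posTP_idTensor_conj [DecidableEq a] {V W : Matrix a a ℂ} (hW : W = V.conjTranspose) (hV : W * V = 1) :
    PosTP (idTensor c fun Y => V * Y * W) := by
  subst hW
  have : (idTensor c fun Y => V * Y * V.conjTranspose) = fun X : Matrix (c × a) (c × a) ℂ =>
      ((1 : Matrix c c ℂ) ⊗ₖ V) * X * ((1 : Matrix c c ℂ) ⊗ₖ V).conjTranspose := by
    funext X
    rw [idTensor_conj, Matrix.conjTranspose_kronecker, Matrix.conjTranspose_one]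
  rw [this]
  refine posTP_conj ?_
  rw [Matrix.conjTranspose_kronecker, ← Matrix.mul_kronecker_mul, hV, Matrix.conjTranspose_one,
    one_mul, Matrix.one_kronecker_one]

lemma sum_one_kronecker_mul [DecidableEq a] {F : Fin 2 → Matrix a a ℂ} (h : ∑ k, F k * F k = 1) :
    ∑ k, ((1 : Matrix c c ℂ) ⊗ₖ F k) * ((1 : Matrix c c ℂ) ⊗ₖ F k) = 1 := by
  simp only [← Matrix.mul_kronecker_mul, one_mul]
  rw [Fin.sum_univ_two] at h ⊢
  rw [← Matrix.kronecker_add, h, Matrix.one_kronecker_one]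

lemma posTP_idTensor_measure [DecidableEq a] (κ : OrthonormalBasis (Fin 2) ℂ (EuclideanSpace ℂ r))
    {F : Fin 2 → Matrix a a ℂ} (hF : ∀ k, (F k).IsHermitian) (hsum : ∑ k, F k * F k = 1) :
    PosTP (idTensor c (measure κ F)) := by
  have : idTensor c (measure κ F) = fun X : Matrix (c × a) (c × a) ℂ =>
      Matrix.reindex (Equiv.prodAssoc c a r) (Equiv.prodAssoc c a r)
        (measure κ (fun k => (1 : Matrix c c ℂ) ⊗ₖ F k) X) := funext (idTensor_measure κ F)
  rw [this]
  exact (posTP_reindex _).comp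
    (posTP_measure κ (fun k => one_kronecker_isHermitian (hF k)) (sum_one_kronecker_mul hsum))

end Measurement

/-! ### Disturbance by a measurement that is close to a projective one -/

section Disturbance

variable {n r : Type} [Fintype n] [Fintype r]

/-- Squared Hilbert-Schmidt norm. -/
def hsSq (A : Matrix n n ℂ) : ℝ := (A * A.conjTranspose).trace.re

lemma hsSq_nonneg (A : Matrix n n ℂ) : 0 ≤ hsSq A :=
  re_trace_nonneg (Matrix.posSemidef_self_mul_conjTranspose A)

lemma hsSq_add_add_hsSq_sub (A B : Matrix n n ℂ) :
    hsSq (A + B) + hsSq (A - B) = 2 * hsSq A + 2 * hsSq B := by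
  simp only [hsSq, ← Complex.add_re, ← Matrix.trace_add]
  have : (A + B) * (A + B).conjTranspose + (A - B) * (A - B).conjTranspose
      = (A * A.conjTranspose + A * A.conjTranspose) + (B * B.conjTranspose + B * B.conjTranspose) := by
    simp only [Matrix.conjTranspose_add, Matrix.conjTranspose_sub]
    noncomm_ring
  rw [this]
  simp only [Matrix.trace_add, Complex.add_re]
  ring

lemma hsSq_add_le (A B : Matrix n n ℂ) : hsSq (A + B) ≤ 2 * hsSq A + 2 * hsSq B := by
  linarith [hsSq_add_add_hsSq_sub A B, hsSq_nonneg (A - B)]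

lemma hsSq_sub_le (A B : Matrix n n ℂ) : hsSq (A - B) ≤ 2 * hsSq A + 2 * hsSq B := by
  linarith [hsSq_add_add_hsSq_sub A B, hsSq_nonneg (A + B)]

lemma hsSq_smul (x : ℝ) (A : Matrix n n ℂ) : hsSq ((x : ℂ) • A) = x ^ 2 * hsSq A := by
  simp [hsSq, Matrix.conjTranspose_smul, smul_smul]
  left
  ring

/-- With D = A − B and S = A + B, polarization writes AA† − BB† = (DS† + SD†)/2 as a difference of
the squares of xD ± yS whenever xy = 1/4. It plays the role of the Cauchy–Schwarz bound ‖D‖₂‖S‖₂,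
with the arithmetic-geometric weight μ left free. -/
lemma diffBound_mul_conjTranspose_sub (A B : Matrix n n ℂ) {μ : ℝ} (hμ : 0 < μ) :
    DiffBound (A * A.conjTranspose - B * B.conjTranspose)
      ((μ ^ 2 * hsSq (A - B) + (μ ^ 2)⁻¹ * hsSq (A + B)) / 2) := by
  set x : ℂ := ((μ / 2 : ℝ) : ℂ) with hx
  set y : ℂ := ((μ⁻¹ / 2 : ℝ) : ℂ) with hy
  have hxy : x * y = 1 / 4 := by
    rw [hx, hy, ← Complex.ofReal_mul]
    have : μ / 2 * (μ⁻¹ / 2) = 1 / 4 := by field_simp; norm_num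
    rw [this]; norm_num
  have hxs : star x = x := Complex.conj_ofReal _
  have hys : star y = y := Complex.conj_ofReal _
  set D := A - B with hD
  set S := A + B with hS
  refine ⟨(x • D + y • S) * (x • D + y • S).conjTranspose,
    (x • D - y • S) * (x • D - y • S).conjTranspose,
    Matrix.posSemidef_self_mul_conjTranspose _, Matrix.posSemidef_self_mul_conjTranspose _,
    ?_, le_of_eq ?_⟩
  · have h1 : (x • D + y • S) * (x • D + y • S).conjTranspose
        - (x • D - y • S) * (x • D - y • S).conjTranspose
        = (2 * (x * y)) • (D * S.conjTranspose + S * D.conjTranspose) := by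
      simp only [Matrix.conjTranspose_add, Matrix.conjTranspose_sub, Matrix.conjTranspose_smul,
        hxs, hys, Matrix.add_mul, Matrix.sub_mul, Matrix.mul_add, Matrix.mul_sub,
        Matrix.smul_mul, Matrix.mul_smul, smul_smul, smul_add, smul_sub]
      module
    rw [h1, hxy, hD, hS]
    have h2 : (A - B) * (A + B).conjTranspose + (A + B) * (A - B).conjTranspose
        = (2 : ℂ) • (A * A.conjTranspose - B * B.conjTranspose) := by
      simp only [Matrix.conjTranspose_add, Matrix.conjTranspose_sub, two_smul]
      noncomm_ring
    rw [h2, smul_smul]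
    norm_num
  · change hsSq (x • D + y • S) + hsSq (x • D - y • S) = _
    rw [hsSq_add_add_hsSq_sub, hsSq_smul, hsSq_smul]
    field_simp

variable [DecidableEq n]

/-- Disturbance of a state `ω` by one Kraus operator of a measurement that is close to a projection. -/
lemma diffBound_kraus {F F' P P' ω : Matrix n n ℂ} (hω : IsState ω) (hF : F.PosSemidef)
    (hF1 : (1 - F).PosSemidef) (hFF : F * F + F' * F' = 1) (hP : P.IsHermitian)
    (hP' : P'.IsHermitian) (hPP : P + P' = 1) {μ : ℝ} (hμ : 0 < μ) :
    DiffBound (F * ω * F - P * ω * P)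
      (μ ^ 2 * (((1 - F * F) * (P * ω * P)).trace.re + ((1 - F' * F') * (P' * ω * P')).trace.re)
        + (μ ^ 2)⁻¹ * ((F * F * ω).trace.re + (P * P * ω).trace.re)) := by
  -- A root of ω turns traces against ω into Hilbert–Schmidt norms, so that the polarization bound
  -- applies to FY and PY.
  obtain ⟨Y, hY⟩ : ∃ Y : Matrix n n ℂ, ω = Y * Y.conjTranspose := by
    refine ⟨CFC.sqrt ω, ?_⟩
    rw [sqrt_conjTranspose, sqrt_mul_sqrt hω.1]
  have hs : ∀ Z : Matrix n n ℂ, Z.IsHermitian →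
      (Z * Y) * (Z * Y).conjTranspose = Z * ω * Z := fun Z hZ => by
    rw [Matrix.conjTranspose_mul, hZ.eq, hY]; simp only [mul_assoc]
  have hs' : ∀ Z : Matrix n n ℂ, Z.IsHermitian → hsSq (Z * Y) = (Z * Z * ω).trace.re :=
    fun Z hZ => by rw [hsSq, hs Z hZ, Matrix.trace_mul_cycle]
  have hFh := hF.isHermitian
  have h0 := diffBound_mul_conjTranspose_sub (F * Y) (P * Y) hμ
  rw [hs F hFh, hs P hP] at h0
  have hsum : hsSq (F * Y + P * Y) ≤ 2 * ((F * F * ω).trace.re + (P * P * ω).trace.re) := by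
    have := hsSq_add_le (F * Y) (P * Y)
    rw [hs' F hFh, hs' P hP] at this
    linarith
  have hPY : (P * Y) * (P * Y).conjTranspose = P * ω * P := hs P hP
  have hPY' : (P' * Y) * (P' * Y).conjTranspose = P' * ω * P' := hs P' hP'
  -- This is (1 − F)² ≤ 1 − F². The difference 2F(1 − F) is written as twice F(1 − F)F + (1 − F)F(1
  -- − F), which is visibly positive.
  have hd1 : hsSq ((1 - F) * (P * Y)) ≤ ((1 - F * F) * (P * ω * P)).trace.re := by
    have e1 : hsSq ((1 - F) * (P * Y)) = ((1 - F) * (1 - F) * (P * ω * P)).trace.re := by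
      rw [hsSq, Matrix.conjTranspose_mul, hF1.isHermitian.eq]
      have : (1 - F) * (P * Y) * ((P * Y).conjTranspose * (1 - F))
          = (1 - F) * ((P * Y) * (P * Y).conjTranspose) * (1 - F) := by simp only [mul_assoc]
      rw [this, hPY, Matrix.trace_mul_cycle]
    have hpos : (F * (1 - F) * F + (1 - F) * F * (1 - F)).PosSemidef := by
      have h1 := hF1.mul_mul_conjTranspose_same F
      have h2 := hF.mul_mul_conjTranspose_same (1 - F)
      rw [hFh.eq] at h1
      rw [hF1.isHermitian.eq] at h2
      exact h1.add h2
    have hω' : (P * ω * P).PosSemidef := by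
      have := hω.1.mul_mul_conjTranspose_same P
      rwa [hP.eq] at this
    have h3 := re_trace_mul_nonneg hpos hω'
    have e2 : 1 - F * F = (1 - F) * (1 - F) +
        ((F * (1 - F) * F + (1 - F) * F * (1 - F)) + (F * (1 - F) * F + (1 - F) * F * (1 - F))) := by
      noncomm_ring
    rw [e1, e2, add_mul, add_mul]
    simp only [Matrix.trace_add, Complex.add_re]
    linarith
  have hd2 : hsSq (F * (P' * Y)) = ((1 - F' * F') * (P' * ω * P')).trace.re := by
    have : 1 - F' * F' = F * F := by rw [← hFF]; abel
    rw [this, hsSq, Matrix.conjTranspose_mul, hFh.eq]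
    have : F * (P' * Y) * ((P' * Y).conjTranspose * F)
        = F * ((P' * Y) * (P' * Y).conjTranspose) * F := by simp only [mul_assoc]
    rw [this, hPY', Matrix.trace_mul_cycle]
  have hd : hsSq (F * Y - P * Y) ≤ 2 * (((1 - F * F) * (P * ω * P)).trace.re
      + ((1 - F' * F') * (P' * ω * P')).trace.re) := by
    -- Splitting along P + P' = 1 leaves only the two ways of failing: outcome F on the range of P',
    -- and no outcome F on the range of P.
    have e : F * Y - P * Y = F * (P' * Y) - (1 - F) * (P * Y) := by
      have : P' = 1 - P := by rw [← hPP]; abel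
      rw [this]
      noncomm_ring
    have := hsSq_sub_le (F * (P' * Y)) ((1 - F) * (P * Y))
    rw [← e] at this
    linarith
  obtain ⟨A, B, hA, hB, hAB, hle⟩ := h0
  refine ⟨A, B, hA, hB, hAB, hle.trans ?_⟩
  have h1 := mul_le_mul_of_nonneg_left hd (sq_nonneg μ)
  have h2 := mul_le_mul_of_nonneg_left hsum (inv_nonneg.2 (sq_nonneg μ))
  linarith

/-- Summed over both outcomes, the one-operator bound is 2μ²q + 2μ⁻², since each family of outcome
probabilities adds up to one. The optimal weight μ² = 1/√q would give 4√q. -/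
lemma diffBound_measure_sub (κ : OrthonormalBasis (Fin 2) ℂ (EuclideanSpace ℂ r))
    {F P : Fin 2 → Matrix n n ℂ} {ω : Matrix n n ℂ} (hω : IsState ω)
    (hF : ∀ k, (F k).PosSemidef) (hF1 : ∀ k, (1 - F k).PosSemidef) (hFF : ∑ k, F k * F k = 1)
    (hP : IsPVM P) {q t : ℝ}
    (hq : q = ∑ k, ((1 - F k * F k) * (P k * ω * P k)).trace.re) (hq0 : 0 ≤ q)
    (ht : 4 * √q < t) : DiffBound (measure κ F ω - measure κ P ω) t := by
  obtain ⟨hPk, hP1⟩ := hP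
  have hPP : ∑ k, P k * P k = 1 := by simp only [(hPk _).2, hP1]
  rw [Fin.sum_univ_two] at hq hFF hP1 hPP
  set x := √q with hx
  have hx0 : 0 ≤ x := Real.sqrt_nonneg q
  have hxx : x * x = q := Real.mul_self_sqrt hq0
  -- The slack d keeps the weight 1/(√q + d) finite when q = 0, and 2q/(√q + d) + 2(√q + d) ≤ 4√q +
  -- 2d = t.
  set d := (t - 4 * x) / 2 with hd
  have hd0 : 0 < d := by rw [hd]; linarith
  set μ := √((x + d)⁻¹) with hμ
  have hμ0 : 0 < μ := Real.sqrt_pos.2 (by positivity)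
  have hμ2 : μ ^ 2 = (x + d)⁻¹ := Real.sq_sqrt (by positivity)
  have h0 := diffBound_kraus hω (hF 0) (hF1 0) hFF (hPk 0).1 (hPk 1).1 hP1 hμ0
  have h1 := diffBound_kraus hω (hF 1) (hF1 1) (by rwa [add_comm]) (hPk 1).1 (hPk 0).1
    (by rwa [add_comm]) hμ0
  have hF2 : (F 0 * F 0 * ω).trace.re + (F 1 * F 1 * ω).trace.re = 1 := by
    rw [← Complex.add_re, ← Matrix.trace_add, ← add_mul, hFF, one_mul, hω.2, Complex.one_re]
  have hP2 : (P 0 * P 0 * ω).trace.re + (P 1 * P 1 * ω).trace.re = 1 := by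
    rw [← Complex.add_re, ← Matrix.trace_add, ← add_mul, hPP, one_mul, hω.2, Complex.one_re]
  have key := ((posTP_kronecker_right (isState_ketBra_basis κ 0)).diffBound h0).add
    ((posTP_kronecker_right (isState_ketBra_basis κ 1)).diffBound h1)
  have e : measure κ F ω - measure κ P ω = (F 0 * ω * F 0 - P 0 * ω * P 0) ⊗ₖ ketBra (κ 0)
      + (F 1 * ω * F 1 - P 1 * ω * P 1) ⊗ₖ ketBra (κ 1) := by
    simp only [measure, Fin.sum_univ_two, (posTP_kronecker_right (isState_ketBra_basis κ _)).map_sub]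
    abel
  rw [e]
  obtain ⟨A, B, hA, hB, hAB, hle⟩ := key
  refine ⟨A, B, hA, hB, hAB, hle.trans ?_⟩
  have hb : (x + d)⁻¹ * q ≤ x := by
    rw [inv_mul_le_iff₀ (by positivity), ← hxx]
    nlinarith
  have : ∀ q0 q1 f0 f1 p0 p1 : ℝ, q = q0 + q1 → f0 + f1 = 1 → p0 + p1 = 1 →
      (x + d)⁻¹ * (q0 + q1) + (x + d)⁻¹⁻¹ * (f0 + p0) +
        ((x + d)⁻¹ * (q1 + q0) + (x + d)⁻¹⁻¹ * (f1 + p1)) ≤ t := by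
    intro q0 q1 f0 f1 p0 p1 h1 h2 h3
    rw [inv_inv, add_comm q1 q0, ← h1]
    have : (x + d) * (f0 + p0) + (x + d) * (f1 + p1) = 2 * (x + d) := by
      rw [← mul_add]
      have : f0 + p0 + (f1 + p1) = 2 := by linarith
      rw [this]; ring
    linarith
  rw [hμ2]
  exact this _ _ _ _ _ _ hq hF2 hP2

end Disturbance

/-! ### One round of reusing the ancilla -/

noncomputable section

section Reuse

/-- `(C B) A ≃ C (A B)`. -/
def attachEquiv (c b a : Type) : (c × b) × a ≃ c × (a × b) :=
  (Equiv.prodAssoc c b a).trans (Equiv.prodCongr (Equiv.refl c) (Equiv.prodComm b a))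

/-- `C (X Y) ≃ (C Y) X`. -/
def exposeEquiv (c x y : Type) : c × (x × y) ≃ (c × y) × x :=
  (Equiv.prodCongr (Equiv.refl c) (Equiv.prodComm x y)).trans (Equiv.prodAssoc c y x).symm

/-- `(C Y) (X R) ≃ (C R) (X Y)`. -/
def exchangeEquiv (c x y r : Type) : (c × y) × (x × r) ≃ (c × r) × (x × y) :=
  (Equiv.prodAssoc c y (x × r)).trans <|
    (Equiv.prodCongr (Equiv.refl c)
      ((Equiv.prodAssoc y x r).symm.trans
        ((Equiv.prodComm (y × x) r).trans
          (Equiv.prodCongr (Equiv.refl r) (Equiv.prodComm y x))))).trans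
    (Equiv.prodAssoc c r (x × y)).symm

/-- `(C R) (A B) ≃ (C (A R)) B`. -/
def storeEquiv (c a b r : Type) : (c × r) × (a × b) ≃ (c × (a × r)) × b :=
  (Equiv.prodAssoc c r (a × b)).trans <|
    (Equiv.prodCongr (Equiv.refl c)
      ((Equiv.prodAssoc r a b).symm.trans
        (Equiv.prodCongr (Equiv.prodComm r a) (Equiv.refl b)))).trans
    (Equiv.prodAssoc c (a × r) b).symm

/-- `(C X) R ≃ (C R) X`. -/
def passEquiv (c x r : Type) : (c × x) × r ≃ (c × r) × x :=
  (Equiv.prodAssoc c x r).trans <|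
    (Equiv.prodCongr (Equiv.refl c) (Equiv.prodComm x r)).trans (Equiv.prodAssoc c r x).symm

/-- `C ((A B) R) ≃ (C (A R)) B`. -/
def storeEquiv' (c a b r : Type) : c × ((a × b) × r) ≃ (c × (a × r)) × b :=
  (Equiv.prodAssoc c (a × b) r).symm.trans ((passEquiv c (a × b) r).trans (storeEquiv c a b r))

/-- In the ideal round the measurement ignores B, so η factors out again and is ready for the next
round. -/
lemma reindex_kronecker_measure {a b c r : Type} [Fintype a] [Fintype b] [DecidableEq b]
    [Fintype r] (κ : OrthonormalBasis (Fin 2) ℂ (EuclideanSpace ℂ r))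
    (P : Fin 2 → Matrix a a ℂ) (ρ : Matrix a a ℂ) (Z : Matrix c c ℂ) (η : Matrix b b ℂ) :
    Matrix.reindex (storeEquiv' c a b r) (storeEquiv' c a b r)
      (Z ⊗ₖ measure κ (fun k => P k ⊗ₖ (1 : Matrix b b ℂ)) (ρ ⊗ₖ η)) =
      (Z ⊗ₖ measure κ P ρ) ⊗ₖ η := by
  simp only [measure, ← Matrix.mul_kronecker_mul, one_mul, mul_one]
  ext ⟨⟨i, j, s⟩, k⟩ ⟨⟨i', j', s'⟩, k'⟩
  simp [storeEquiv', storeEquiv, passEquiv]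
  ring

variable {a a' b b' c r : Type} [Fintype a] [Fintype a'] [Fintype b] [Fintype b']
  [DecidableEq b'] [Fintype c] [DecidableEq c] [Fintype r]

/-- Attach a fresh `ρ` on `A` to a state of `C B`, measure `A B` with Kraus operators `F` and
store `A` with the outcome in `C`. -/
def reuse (κ : OrthonormalBasis (Fin 2) ℂ (EuclideanSpace ℂ r))
    (F : Fin 2 → Matrix (a × b) (a × b) ℂ) (ρ : Matrix a a ℂ) (X : Matrix (c × b) (c × b) ℂ) :
    Matrix ((c × (a × r)) × b) ((c × (a × r)) × b) ℂ :=
  Matrix.reindex ((passEquiv c (a × b) r).trans (storeEquiv c a b r))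
    ((passEquiv c (a × b) r).trans (storeEquiv c a b r))
    (measure κ (fun k => (1 : Matrix c c ℂ) ⊗ₖ F k)
      (Matrix.reindex (attachEquiv c b a) (attachEquiv c b a) (X ⊗ₖ ρ)))

lemma posTP_reuse [DecidableEq a] [DecidableEq b] (κ : OrthonormalBasis (Fin 2) ℂ (EuclideanSpace ℂ r))
    {F : Fin 2 → Matrix (a × b) (a × b) ℂ} (hF : ∀ k, (F k).IsHermitian)
    (hFF : ∑ k, F k * F k = 1) {ρ : Matrix a a ℂ} (hρ : IsState ρ) :
    PosTP (reuse (c := c) κ F ρ) :=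
  (posTP_reindex _).comp <|
    (posTP_measure κ (fun k => one_kronecker_isHermitian (hF k)) (sum_one_kronecker_mul hFF)).comp <|
    (posTP_reindex _).comp (posTP_kronecker_right hρ)

lemma reuse_kronecker (κ : OrthonormalBasis (Fin 2) ℂ (EuclideanSpace ℂ r))
    (F : Fin 2 → Matrix (a × b) (a × b) ℂ) (ρ : Matrix a a ℂ) (Z : Matrix c c ℂ)
    (η : Matrix b b ℂ) :
    reuse κ F ρ (Z ⊗ₖ η) = Matrix.reindex (storeEquiv' c a b r) (storeEquiv' c a b r)
      (Z ⊗ₖ measure κ F (ρ ⊗ₖ η)) := by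
  have h : Matrix.reindex (attachEquiv c b a) (attachEquiv c b a) ((Z ⊗ₖ η) ⊗ₖ ρ)
      = Z ⊗ₖ (ρ ⊗ₖ η) := by
    ext ⟨i, j, k⟩ ⟨i', j', k'⟩
    simp [attachEquiv]
    ring
  rw [reuse, h]
  simp only [measure, ← Matrix.mul_kronecker_mul, one_mul, mul_one]
  ext ⟨⟨i, j, s⟩, k⟩ ⟨⟨i', j', s'⟩, k'⟩
  simp [storeEquiv']
  ring

/-- The effective Kraus operator `U† (G ⊗ 1) U` on `A B`, with `e` identifying `A B = A' B'`. -/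
def effKraus (e : a × b ≃ a' × b') (U : Matrix (a × b) (a × b) ℂ) (G : Matrix a' a' ℂ) :
    Matrix (a × b) (a × b) ℂ :=
  U.conjTranspose * Matrix.reindex e.symm e.symm (G ⊗ₖ (1 : Matrix b' b' ℂ)) * U

/-- Rotating by `U`, measuring `A'` and rotating back measures `A B` with the effective Kraus
operators. -/
lemma rotate_measure_rotate [DecidableEq r] (κ : OrthonormalBasis (Fin 2) ℂ (EuclideanSpace ℂ r))
    (e : a × b ≃ a' × b') (U : Matrix (a × b) (a × b) ℂ) (G : Fin 2 → Matrix a' a' ℂ)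
    (X : Matrix (c × (a × b)) (c × (a × b)) ℂ) :
    idTensor (c × r) (fun Y => U.conjTranspose * Y * U)
      (Matrix.reindex ((exchangeEquiv c a' b' r).trans
          (Equiv.prodCongr (Equiv.refl (c × r)) e.symm))
        ((exchangeEquiv c a' b' r).trans (Equiv.prodCongr (Equiv.refl (c × r)) e.symm))
        (idTensor (c × b') (measure κ G)
          (Matrix.reindex ((Equiv.prodCongr (Equiv.refl c) e).trans (exposeEquiv c a' b'))
            ((Equiv.prodCongr (Equiv.refl c) e).trans (exposeEquiv c a' b'))
            (idTensor c (fun Y => U * Y * U.conjTranspose) X)))) =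
      Matrix.reindex (passEquiv c (a × b) r) (passEquiv c (a × b) r)
        (measure κ (fun k => (1 : Matrix c c ℂ) ⊗ₖ effKraus e U (G k)) X) := by
  set s := (Equiv.prodCongr (Equiv.refl c) e).trans (exposeEquiv c a' b') with hs
  set w := passEquiv c (a × b) r with hw
  have h1 : ∀ k, (1 : Matrix (c × b') (c × b') ℂ) ⊗ₖ G k = Matrix.reindex s s
      ((1 : Matrix c c ℂ) ⊗ₖ Matrix.reindex e.symm e.symm (G k ⊗ₖ (1 : Matrix b' b' ℂ))) := by
    intro k
    ext ⟨⟨i, j⟩, l⟩ ⟨⟨i', j'⟩, l'⟩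
    by_cases hi : i = i' <;> by_cases hj : j = j' <;>
      simp [hs, exposeEquiv, hi, hj]
  have h2 : ∀ V : Matrix (a × b) (a × b) ℂ, (1 : Matrix (c × r) (c × r) ℂ) ⊗ₖ V =
      Matrix.reindex w w (((1 : Matrix c c ℂ) ⊗ₖ V) ⊗ₖ (1 : Matrix r r ℂ)) := by
    intro V
    ext ⟨⟨i, j⟩, l⟩ ⟨⟨i', j'⟩, l'⟩
    by_cases hi : i = i' <;> by_cases hj : j = j' <;>
      simp [hw, passEquiv, hi, hj]
  have h3 : ∀ k, (1 : Matrix c c ℂ) ⊗ₖ effKraus e U (G k) =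
      ((1 : Matrix c c ℂ) ⊗ₖ U.conjTranspose) *
        ((1 : Matrix c c ℂ) ⊗ₖ Matrix.reindex e.symm e.symm (G k ⊗ₖ (1 : Matrix b' b' ℂ))) *
        ((1 : Matrix c c ℂ) ⊗ₖ U) := by
    intro k
    rw [← Matrix.mul_kronecker_mul, ← Matrix.mul_kronecker_mul, one_mul, one_mul, effKraus]
  rw [idTensor_conj, idTensor_conj, idTensor_measure]
  simp only [h1, h3]
  -- Both sides reduce to one measurement by G ⊗ 1 on the rotated state, conjugated by U† and U;
  -- what remains is a comparison of regroupings.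
  rw [measure_reindex, measure_conj, h2, h2]
  set T := measure κ (fun k => (1 : Matrix c c ℂ) ⊗ₖ
    Matrix.reindex e.symm e.symm (G k ⊗ₖ (1 : Matrix b' b' ℂ)))
      ((1 : Matrix c c ℂ) ⊗ₖ U * X * (1 : Matrix c c ℂ) ⊗ₖ U.conjTranspose)
  have h4 : Matrix.reindex ((exchangeEquiv c a' b' r).trans
          (Equiv.prodCongr (Equiv.refl (c × r)) e.symm))
        ((exchangeEquiv c a' b' r).trans (Equiv.prodCongr (Equiv.refl (c × r)) e.symm))
        (Matrix.reindex (Equiv.prodAssoc (c × b') a' r) (Equiv.prodAssoc (c × b') a' r)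
          (Matrix.reindex (s.prodCongr (Equiv.refl r)) (s.prodCongr (Equiv.refl r)) T)) =
      Matrix.reindex w w T := by
    ext ⟨⟨i, j⟩, l⟩ ⟨⟨i', j'⟩, l'⟩
    simp [hs, hw, exposeEquiv, exchangeEquiv, passEquiv]
  rw [h4]
  simp only [Matrix.reindex_apply, Matrix.submatrix_mul_equiv]

end Reuse

end

/-! ### Effective Kraus operators -/

noncomputable section

section EffKraus

variable {a a' b b' : Type} [Fintype a] [Fintype b] [DecidableEq b']

lemma effKraus_one [DecidableEq a] [DecidableEq b] [DecidableEq a'] (e : a × b ≃ a' × b') {U : Matrix (a × b) (a × b) ℂ}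
    (hU : U.conjTranspose * U = 1) : effKraus e U (1 : Matrix a' a' ℂ) = 1 := by
  rw [effKraus, Matrix.one_kronecker_one, Matrix.reindex_apply, Matrix.submatrix_one_equiv,
    mul_one, hU]

lemma effKraus_sub (e : a × b ≃ a' × b') (U : Matrix (a × b) (a × b) ℂ)
    (G H : Matrix a' a' ℂ) : effKraus e U (G - H) = effKraus e U G - effKraus e U H := by
  have : (G - H) ⊗ₖ (1 : Matrix b' b' ℂ) = G ⊗ₖ 1 - H ⊗ₖ 1 := by ext; simp [sub_mul]
  simp only [effKraus, this, Matrix.reindex_apply, Matrix.submatrix_sub, Pi.sub_apply, mul_sub,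
    sub_mul]

variable [Fintype a'] [Fintype b']

lemma posSemidef_effKraus (e : a × b ≃ a' × b') (U : Matrix (a × b) (a × b) ℂ)
    {G : Matrix a' a' ℂ} (hG : G.PosSemidef) : (effKraus e U G).PosSemidef := by
  have h : (Matrix.reindex e.symm e.symm (G ⊗ₖ (1 : Matrix b' b' ℂ))).PosSemidef :=
    (hG.kronecker Matrix.PosSemidef.one).submatrix _
  exact h.conjTranspose_mul_mul_same U

lemma effKraus_mul [DecidableEq a] [DecidableEq b] (e : a × b ≃ a' × b') {U : Matrix (a × b) (a × b) ℂ}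
    (hU : U * U.conjTranspose = 1) (G H : Matrix a' a' ℂ) :
    effKraus e U G * effKraus e U H = effKraus e U (G * H) := by
  have : Matrix.reindex e.symm e.symm ((G * H) ⊗ₖ (1 : Matrix b' b' ℂ)) =
      Matrix.reindex e.symm e.symm (G ⊗ₖ (1 : Matrix b' b' ℂ)) *
        Matrix.reindex e.symm e.symm (H ⊗ₖ (1 : Matrix b' b' ℂ)) := by
    simp only [Matrix.reindex_apply, Matrix.submatrix_mul_equiv, ← Matrix.mul_kronecker_mul,
      mul_one]
  rw [effKraus, effKraus, effKraus, this]
  simp only [mul_assoc]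
  rw [← mul_assoc U, hU, one_mul]

/-- Statistics of an effective measurement operator are those of `G` on the output `A'`. -/
lemma trace_effKraus_mul (e : a × b ≃ a' × b') (U : Matrix (a × b) (a × b) ℂ)
    (G : Matrix a' a' ℂ) (X : Matrix (a × b) (a × b) ℂ) :
    (effKraus e U G * X).trace =
      (G * partialTrace (Matrix.reindex e e (U * X * U.conjTranspose))).trace := by
  have h1 : (effKraus e U G * X).trace = (Matrix.reindex e.symm e.symm
      (G ⊗ₖ (1 : Matrix b' b' ℂ)) * (U * X * U.conjTranspose)).trace := by
    rw [effKraus, mul_assoc, mul_assoc, Matrix.trace_mul_comm]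
    simp only [mul_assoc]
  have h2 : (Matrix.reindex e.symm e.symm
      (G ⊗ₖ (1 : Matrix b' b' ℂ)) * (U * X * U.conjTranspose)).trace =
      ((G ⊗ₖ (1 : Matrix b' b' ℂ)) * Matrix.reindex e e (U * X * U.conjTranspose)).trace := by
    rw [← (posTP_reindex e).trace]
    congr 1
    simp only [Matrix.reindex_apply]
    rw [← Matrix.submatrix_mul_equiv _ _ _ e.symm]
    simp
  rw [h1, h2]
  generalize Matrix.reindex e e (U * X * U.conjTranspose) = Y
  simp only [Matrix.trace, Matrix.diag_apply, Matrix.mul_apply, partialTrace, Matrix.of_apply,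
    Fintype.sum_prod_type, Matrix.kroneckerMap_apply, Matrix.one_apply, mul_ite, mul_one,
    mul_zero, ite_mul, zero_mul, Finset.sum_ite_eq, Finset.mem_univ, if_true, Finset.mul_sum]
  refine Finset.sum_congr rfl fun i _ => ?_
  rw [Finset.sum_comm]

end EffKraus

/-! ### Resource balance of one round -/

section Systems

variable {E : Type u} {ix : E → Type} [∀ e, Fintype (ix e)] [∀ e, DecidableEq (ix e)]

lemma sqrt_povm_mul {a : Type} [Fintype a] [DecidableEq a] {Q : Fin 2 → Matrix a a ℂ}
    (hQ : IsPOVM Q) : ∑ k, CFC.sqrt (Q k) * CFC.sqrt (Q k) = 1 := by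
  simp only [sqrt_mul_sqrt (hQ.1 _), hQ.2]

lemma one_sub_sqrt_povm {a : Type} [Fintype a] [DecidableEq a] {Q : Fin 2 → Matrix a a ℂ}
    (hQ : IsPOVM Q) (k : Fin 2) : (1 - CFC.sqrt (Q k)).PosSemidef := by
  have h1 : Q k ≤ 1 := by
    rw [← hQ.2]
    exact Finset.single_le_sum (f := Q)
      (fun i _ => Matrix.nonneg_iff_posSemidef.2 (hQ.1 i)) (Finset.mem_univ k)
  have hs : IsSelfAdjoint (Q k) := (hQ.1 k).isHermitian
  rw [← cfc_id ℝ (Q k), cfc_le_one_iff id (Q k) (continuousOn_spectrum _ _) hs] at h1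
  rw [← Matrix.le_iff, CFC.sqrt_eq_real_sqrt _ (Matrix.nonneg_iff_posSemidef.2 (hQ.1 k)),
    cfcₙ_eq_cfc]
  exact cfc_le_one _ _ fun x hx => Real.sqrt_le_one.2 (h1 x hx)

variable {T : ResourceTheory ix} {M : StateFunction ix} {c : ℝ → ℝ} {cmax : ℝ}

/-- One round of reusing the ancilla costs at most the fresh copy of `ρ` and the
resource-increasing power of the measurement. -/
lemma resource_reuse_le (hM : IsResourceMeasure T M c cmax) {A A' B B' K : Sys E}
    {e : (Sys.comp A B).idx ix ≃ (Sys.comp A' B').idx ix}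
    (he : Regroup ix (.comp A B) (.comp A' B') e)
    {U : Matrix.unitaryGroup ((Sys.comp A B).idx ix) ℂ} (hU : U ∈ T.freeUnitaries (.comp A B))
    (κ : OrthonormalBasis (Fin 2) ℂ (EuclideanSpace ℂ (K.idx ix)))
    {Q : Fin 2 → Op ix A'} (hQ : IsPOVM Q) {L : ℝ}
    (hL : ∀ (R : Sys E) (σ : Op ix (.comp R A')), IsState σ →
      gain M (S := .comp R A') (S' := .comp R (.comp A' K))
        (idTensor (R.idx ix) (measPOVM κ Q)) σ ≤ L)
    (C : Sys E) {ρ : Op ix A} (hρ : IsState ρ) {X : Op ix (.comp C B)} (hX : IsState X) :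
    M (.comp (.comp C (.comp A K)) B)
      (reuse κ (fun k => effKraus e (U : Op ix (.comp A B)) (CFC.sqrt (Q k))) ρ X) ≤
      M (.comp C B) X + M A ρ + L := by
  have hUU : (U : Op ix (.comp A B)).conjTranspose * (U : Op ix (.comp A B)) = 1 :=
    Matrix.UnitaryGroup.star_mul_self U
  have hUU' : (U : Op ix (.comp A B)) * (U : Op ix (.comp A B)).conjTranspose = 1 :=
    Matrix.mem_unitaryGroup_iff.1 U.2
  have r0 : Regroup ix (.comp (.comp C B) A) (.comp C (.comp A B)) (attachEquiv _ _ _) :=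
    (Regroup.assoc C B A).trans ((Regroup.refl C).congr (.swap B A))
  have r1 : Regroup ix (.comp C (.comp A B)) (.comp (.comp C B') A')
      ((Equiv.prodCongr (Equiv.refl _) e).trans (exposeEquiv _ _ _)) :=
    ((Regroup.refl C).congr he).trans
      (((Regroup.refl C).congr (.swap A' B')).trans (Regroup.assoc C B' A').symm)
  have r2 : Regroup ix (.comp (.comp C B') (.comp A' K)) (.comp (.comp C K) (.comp A B))
      ((exchangeEquiv _ _ _ _).trans (Equiv.prodCongr (Equiv.refl _) e.symm)) := by
    refine Regroup.trans (T := .comp (.comp C K) (.comp A' B')) ?_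
      ((Regroup.refl (.comp C K)).congr he.symm)
    exact (Regroup.assoc C B' (.comp A' K)).trans
      (((Regroup.refl C).congr ((Regroup.assoc B' A' K).symm.trans
        ((Regroup.swap (.comp B' A') K).trans ((Regroup.refl K).congr (.swap B' A'))))).trans
      (Regroup.assoc C K (.comp A' B')).symm)
  have r3 : Regroup ix (.comp (.comp C K) (.comp A B)) (.comp (.comp C (.comp A K)) B)
      (storeEquiv _ _ _ _) :=
    (Regroup.assoc C K (.comp A B)).trans
      (((Regroup.refl C).congr ((Regroup.assoc K A B).symm.trans
        ((Regroup.swap K A).congr (.refl B)))).trans (Regroup.assoc C (.comp A K) B).symm)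
  set Y0 : Op ix (.comp C (.comp A B)) :=
    Matrix.reindex (attachEquiv _ _ _) (attachEquiv _ _ _) (X ⊗ₖ ρ) with hY0
  have s0' : IsState (X ⊗ₖ ρ) := isState_kronecker hX hρ
  have s0 : IsState Y0 := (posTP_reindex _).isState s0'
  have m0 : M _ Y0 ≤ M (.comp C B) X + M A ρ := by
    rw [← hM.additive _ _ X ρ hX hρ]
    exact hM.monotone _ _ _ (.regroup r0) _ s0'
  set Y1 : Op ix (.comp C (.comp A B)) := idTensor (C.idx ix)
    (fun Y => (U : Op ix (.comp A B)) * Y * (U : Op ix (.comp A B)).conjTranspose) Y0 with hY1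
  have s1 : IsState Y1 := (posTP_idTensor_conj rfl hUU).isState s0
  have m1 : M _ Y1 ≤ M _ Y0 := hM.monotone _ _ _ (.unitary C (.comp A B) U hU) _ s0
  set Y2 : Op ix (.comp (.comp C B') A') :=
    Matrix.reindex ((Equiv.prodCongr (Equiv.refl _) e).trans (exposeEquiv _ _ _))
      ((Equiv.prodCongr (Equiv.refl _) e).trans (exposeEquiv _ _ _)) Y1 with hY2
  have s2 : IsState Y2 := (posTP_reindex _).isState s1
  have m2 : M _ Y2 ≤ M _ Y1 := hM.monotone _ _ _ (.regroup r1) _ s1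
  set Y3 : Op ix (.comp (.comp C B') (.comp A' K)) :=
    idTensor ((Sys.comp C B').idx ix) (measPOVM κ Q) Y2 with hY3
  have s3 : IsState Y3 := (posTP_idTensor_measure κ
    (fun k => (sqrt_posSemidef (Q k)).isHermitian) (sqrt_povm_mul hQ)).isState s2
  -- Apart from the fresh ρ, this is the only step that may raise M. Everything outside A',
  -- including B', serves as the reference in the supremum defining the power.
  have m3 : M _ Y3 ≤ M _ Y2 + L := by
    have := hL (.comp C B') Y2 s2
    rw [gain] at this
    linarith
  set Y4 : Op ix (.comp (.comp C K) (.comp A B)) :=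
    Matrix.reindex ((exchangeEquiv _ _ _ _).trans (Equiv.prodCongr (Equiv.refl _) e.symm))
      ((exchangeEquiv _ _ _ _).trans (Equiv.prodCongr (Equiv.refl _) e.symm)) Y3 with hY4
  have s4 : IsState Y4 := (posTP_reindex _).isState s3
  have m4 : M _ Y4 ≤ M _ Y3 := hM.monotone _ _ _ (.regroup r2) _ s3
  set Y5 : Op ix (.comp (.comp C K) (.comp A B)) := idTensor ((Sys.comp C K).idx ix)
    (fun Y => (U : Op ix (.comp A B)).conjTranspose * Y * (U : Op ix (.comp A B))) Y4 with hY5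
  have s5 : IsState Y5 :=
    (posTP_idTensor_conj (Matrix.conjTranspose_conjTranspose _).symm hUU').isState s4
  -- Monotonicity under duals of free unitaries is what makes undoing U free.
  have m5 : M _ Y5 ≤ M _ Y4 := hM.monotone _ _ _ (.dual (.comp C K) (.comp A B) U hU) _ s4
  have h5 : Y5 = Matrix.reindex (passEquiv _ _ _) (passEquiv _ _ _)
      (measure κ (fun k => (1 : Op ix C) ⊗ₖ
        effKraus e (U : Op ix (.comp A B)) (CFC.sqrt (Q k))) Y0) :=
    rotate_measure_rotate κ e (U : Op ix (.comp A B)) (fun k => CFC.sqrt (Q k)) Y0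
  have h6 : reuse κ (fun k => effKraus e (U : Op ix (.comp A B)) (CFC.sqrt (Q k))) ρ X =
      Matrix.reindex (storeEquiv _ _ _ _) (storeEquiv _ _ _ _) Y5 := by
    rw [h5]; rfl
  have m6 := hM.monotone _ _ _ (.regroup r3) _ s5
  rw [h6]
  linarith

end Systems

end

/-! ### Exact implementations, resource values, and m rounds of reuse -/

noncomputable section

lemma isState_one : IsState (1 : Matrix Unit Unit ℂ) := ⟨.one, by simp⟩

lemma isState_tensorPow {E : Type u} {ix : E → Type} [∀ e, Fintype (ix e)] {S : Sys E}
    {ρ : Op ix S} (hρ : IsState ρ) : ∀ m, IsState (tensorPow ix ρ m)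
  | 0 => isState_one
  | m + 1 => isState_kronecker (isState_tensorPow hρ m) hρ

section Systems

variable {E : Type u} {ix : E → Type} [∀ e, Fintype (ix e)] [∀ e, DecidableEq (ix e)]

lemma idTensor_one_kronecker {a b : Type} (Γ : Matrix a a ℂ → Matrix b b ℂ) (X : Matrix a a ℂ) :
    idTensor (Fin 1) Γ ((1 : Matrix (Fin 1) (Fin 1) ℂ) ⊗ₖ X) = 1 ⊗ₖ Γ X := by
  ext ⟨i, j⟩ ⟨k, l⟩
  obtain rfl : i = k := Subsingleton.elim _ _
  simp only [idTensor, Matrix.of_apply, Matrix.kroneckerMap_apply, Matrix.one_apply_eq, one_mul]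
  rfl

lemma isState_one_fin_one : IsState (1 : Matrix (Fin 1) (Fin 1) ℂ) :=
  ⟨.one, by simp⟩

lemma one_kronecker_injective {a : Type} {X Y : Matrix a a ℂ}
    (h : (1 : Matrix (Fin 1) (Fin 1) ℂ) ⊗ₖ X = 1 ⊗ₖ Y) : X = Y := by
  ext i j
  simpa using congrFun (congrFun h (0, i)) (0, j)

lemma IsChannel.isState {a b : Type} [Fintype a] [Fintype b]
    {Λ : Matrix a a ℂ →ₗ[ℂ] Matrix b b ℂ} (hΛ : IsChannel Λ) {ρ : Matrix a a ℂ}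
    (hρ : IsState ρ) : IsState (Λ ρ) := by
  refine ⟨?_, by rw [hΛ.2, hρ.2]⟩
  have h := hΛ.1 1 _ (isState_kronecker isState_one_fin_one hρ).1
  rw [idTensor_one_kronecker] at h
  have h' := h.submatrix fun i => ((0 : Fin 1), i)
  convert h'
  ext i j
  simp

lemma posTP_implemented {A A' B B' : Sys E}
    (e : (Sys.comp A B).idx ix ≃ (Sys.comp A' B').idx ix)
    (U : Matrix.unitaryGroup ((Sys.comp A B).idx ix) ℂ) {η : Op ix B} (hη : IsState η) :
    PosTP (implemented e U η) :=
  posTP_partialTrace.comp <| (posTP_reindex e).comp <|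
    (posTP_conj (Matrix.UnitaryGroup.star_mul_self U)).comp (posTP_kronecker_right hη)

/-- A one-dimensional reference suffices, because only the outputs on states of the input system are
needed. -/
lemma ChannelClose.eq_of_zero {a b : Type} [Fintype a] [DecidableEq a] [Fintype b]
    [DecidableEq b] {Λ : Matrix a a ℂ →ₗ[ℂ] Matrix b b ℂ} (hΛ : IsChannel Λ)
    {Γ : Matrix a a ℂ → Matrix b b ℂ} (hΓ : PosTP Γ) (h : ChannelClose 0 Λ Γ)
    {ρ : Matrix a a ℂ} (hρ : IsState ρ) : Λ ρ = Γ ρ := by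
  have h1 := h 1 _ (isState_kronecker isState_one_fin_one hρ)
  rw [idTensor_one_kronecker, idTensor_one_kronecker, purifiedDist] at h1
  refine one_kronecker_injective (eq_of_one_le_fidelity
    (isState_kronecker isState_one_fin_one (hΛ.isState hρ))
    (isState_kronecker isState_one_fin_one (hΓ.isState hρ)) ?_)
  have h2 := Real.sqrt_eq_zero'.1 (le_antisymm h1 (Real.sqrt_nonneg _))
  have h3 := fidelity_nonneg ((1 : Matrix (Fin 1) (Fin 1) ℂ) ⊗ₖ Λ ρ) (1 ⊗ₖ Γ ρ)
  nlinarith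

lemma prior_nonneg {p : ℝ} (hp : p ∈ Set.Icc (0 : ℝ) 1) (k : Fin 2) : 0 ≤ prior p k := by
  fin_cases k
  · exact hp.1
  · simpa [prior] using hp.2

lemma one_sub_povm_posSemidef {a : Type} [Fintype a] [DecidableEq a] {Q : Fin 2 → Matrix a a ℂ}
    (hQ : IsPOVM Q) (k : Fin 2) : (1 - Q k).PosSemidef := by
  rw [← Matrix.le_iff, ← hQ.2]
  exact Finset.single_le_sum (f := Q)
    (fun i _ => Matrix.nonneg_iff_posSemidef.2 (hQ.1 i)) (Finset.mem_univ k)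

lemma pFail_nonneg {a : Type} [Fintype a] [DecidableEq a] {Q : Fin 2 → Matrix a a ℂ}
    (hQ : IsPOVM Q) {p : ℝ} (hp : p ∈ Set.Icc (0 : ℝ) 1) {σ : Fin 2 → Matrix a a ℂ}
    (hσ : ∀ k, IsState (σ k)) : 0 ≤ pFail p σ Q :=
  Finset.sum_nonneg fun k _ => mul_nonneg (prior_nonneg hp k)
    (re_trace_mul_nonneg (one_sub_povm_posSemidef hQ k) (hσ k).1)

variable {T : ResourceTheory ix} {M : StateFunction ix} {c : ℝ → ℝ} {cmax : ℝ}

/-- The state 1 ⊗ 1 has value 2M(1) by additivity and M(1) by regrouping in both directions. -/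
lemma resource_one (hM : IsResourceMeasure T M c cmax) :
    M .one (1 : Matrix Unit Unit ℂ) = 0 := by
  have h1 := hM.additive .one .one (1 : Matrix Unit Unit ℂ) (1 : Matrix Unit Unit ℂ)
    isState_one isState_one
  have h2 := isState_kronecker isState_one isState_one
  have h3 := hM.monotone _ _ _ (.regroup (Regroup.unit (.one : Sys E))) _ h2
  have h4 := hM.monotone _ _ _ (.regroup (Regroup.unit (.one : Sys E)).symm) _ isState_one
  have e1 : Matrix.reindex (Equiv.prodPUnit Unit) (Equiv.prodPUnit Unit)
      ((1 : Matrix Unit Unit ℂ) ⊗ₖ (1 : Matrix Unit Unit ℂ)) = 1 := by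
    ext; simp
  have e2 : Matrix.reindex (Equiv.prodPUnit Unit).symm (Equiv.prodPUnit Unit).symm
      (1 : Matrix Unit Unit ℂ) = (1 : Matrix Unit Unit ℂ) ⊗ₖ (1 : Matrix Unit Unit ℂ) := by
    ext; simp
  erw [e1] at h3
  erw [e2] at h4
  linarith

/-- Tracing out the whole system leaves the unique state of the trivial system, whose value is 0. -/
lemma resource_nonneg (hM : IsResourceMeasure T M c cmax) {B : Sys E} {η : Op ix B}
    (hη : IsState η) : 0 ≤ M B η := by
  have h1 := hM.monotone _ _ _ (.regroup (Regroup.unit B).symm) _ hη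
  have s1 : IsState (Matrix.reindex (Equiv.prodPUnit (B.idx ix)).symm
    (Equiv.prodPUnit (B.idx ix)).symm η) := (posTP_reindex _).isState hη
  have h2 := hM.monotone _ _ _ (.regroup (Regroup.swap B .one)) _ s1
  have s2 := (posTP_reindex (Equiv.prodComm (B.idx ix) Unit)).isState s1
  have h3 := hM.monotone _ _ _ (.trace .one B) _ s2
  have s3 := (posTP_partialTrace (m := Unit) (n := B.idx ix)).isState s2
  have e : ∀ X : Matrix Unit Unit ℂ, IsState X → X = 1 := by
    intro X hX
    ext ⟨⟩ ⟨⟩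
    simpa [Matrix.trace] using hX.2
  have h4 := resource_one hM
  rw [← e _ s3] at h4
  exact h4.symm.le.trans (h3.trans (h2.trans h1))

lemma resource_tensorPow (hM : IsResourceMeasure T M c cmax) {S : Sys E} {ρ : Op ix S}
    (hρ : IsState ρ) (m : ℕ) : M (S.copies m) (tensorPow ix ρ m) = m * M S ρ := by
  induction m with
  | zero =>
    rw [Nat.cast_zero, zero_mul]
    exact resource_one hM
  | succ m ih =>
    have := hM.additive _ _ _ _ (isState_tensorPow hρ m) hρ
    rw [ih] at this
    rw [Nat.cast_succ, add_mul, one_mul]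
    exact this

lemma cmax_nonneg (hM : IsResourceMeasure T M c cmax) : 0 ≤ cmax :=
  le_of_tendsto hM.c_tendsto (eventually_nhdsWithin_of_forall fun x hx => hM.c_le x (le_of_lt hx))

/-- The joint state of `m` processed copies and the ancilla after `m` rounds of reuse. -/
def reuseState {A B K : Sys E} (κ : OrthonormalBasis (Fin 2) ℂ (EuclideanSpace ℂ (K.idx ix)))
    (F : Fin 2 → Op ix (.comp A B)) (ρ : Op ix A) (η : Op ix B) :
    (m : ℕ) → Op ix (.comp ((Sys.comp A K).copies m) B)
  | 0 => Matrix.kroneckerMap (· * ·) (1 : Matrix Unit Unit ℂ) η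
  | m + 1 => reuse κ F ρ (reuseState κ F ρ η m)

variable {A B K : Sys E} (κ : OrthonormalBasis (Fin 2) ℂ (EuclideanSpace ℂ (K.idx ix)))
  {F : Fin 2 → Op ix (.comp A B)} {ρ : Op ix A} {η : Op ix B}

lemma isState_reuseState (hF : ∀ k, (F k).IsHermitian) (hFF : ∑ k, F k * F k = 1)
    (hρ : IsState ρ) (hη : IsState η) : ∀ m, IsState (reuseState κ F ρ η m)
  | 0 => isState_kronecker isState_one hη
  | m + 1 => (posTP_reuse κ hF hFF hρ).isState (isState_reuseState hF hFF hρ hη m)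

/-- Telescoping: a round is positive and trace preserving, so it does not enlarge the error
inherited from earlier rounds, and applied to the ideal product state it adds one more t. -/
lemma diffBound_reuseState (hF : ∀ k, (F k).IsHermitian) (hFF : ∑ k, F k * F k = 1)
    (hρ : IsState ρ) {P : Fin 2 → Op ix A} (hP : IsPVM P) {t : ℝ}
    (ht : DiffBound (measure κ F (ρ ⊗ₖ η) -
      measure κ (fun k => P k ⊗ₖ (1 : Op ix B)) (ρ ⊗ₖ η)) t) (m : ℕ) :
    DiffBound (reuseState κ F ρ η m -
      (tensorPow ix (S := .comp A K) (measPVM κ P ρ) m) ⊗ₖ η) (m * t) := by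
  have hρ' : IsState (measPVM κ P ρ) := (posTP_measure κ (fun k => (hP.1 k).1)
    (by simp only [(hP.1 _).2, hP.2])).isState hρ
  induction m with
  | zero =>
    have h : reuseState κ F ρ η 0 -
        (tensorPow ix (S := .comp A K) (measPVM κ P ρ) 0) ⊗ₖ η = 0 := sub_self _
    rw [h]
    simpa using DiffBound.zero
  | succ m ih =>
    have hr := posTP_reuse (c := ((Sys.comp A K).copies m).idx ix) κ hF hFF hρ
    have h1 := hr.diffBound ih
    have h2 := (posTP_reindex (storeEquiv' (((Sys.comp A K).copies m).idx ix) (A.idx ix)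
      (B.idx ix) (K.idx ix))).diffBound ((posTP_kronecker_left (isState_tensorPow
        (S := .comp A K) hρ' m)).diffBound ht)
    have h3 := h1.add h2
    rw [hr.map_sub, (posTP_kronecker_left (isState_tensorPow (S := .comp A K) hρ' m)).map_sub,
      (posTP_reindex _).map_sub, reuse_kronecker, reindex_kronecker_measure,
      sub_add_sub_cancel] at h3
    rw [Nat.cast_succ, add_mul, one_mul]
    exact h3

/-- Reusing the ancilla of an exact implementation of `Λ`: one obtains approximate copies of the
post-measurement state at a bounded cost. -/
lemma exists_approx_copies (hM : IsResourceMeasure T M c cmax) {A' B' : Sys E}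
    {Λ : Op ix A →ₗ[ℂ] Op ix A'} (hΛ : IsChannel Λ)
    {e : (Sys.comp A B).idx ix ≃ (Sys.comp A' B').idx ix}
    (he : Regroup ix (.comp A B) (.comp A' B') e)
    {U : Matrix.unitaryGroup ((Sys.comp A B).idx ix) ℂ} (hU : U ∈ T.freeUnitaries (.comp A B))
    (hη : IsState η) (himp : ChannelClose 0 Λ (implemented e U η))
    {p : ℝ} (hp : p ∈ Set.Icc (0 : ℝ) 1)
    {Ω : Fin 2 → Op ix A} (hΩ : ∀ k, IsState (Ω k))
    {Q : Fin 2 → Op ix A'} (hQ : IsPOVM Q) {L : ℝ}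
    (hL : ∀ (R : Sys E) (σ : Op ix (.comp R A')), IsState σ →
      gain M (S := .comp R A') (S' := .comp R (.comp A' K))
        (idTensor (R.idx ix) (measPOVM κ Q)) σ ≤ L)
    (hρ : IsState ρ) {P : Fin 2 → Op ix A} (hP : IsPVM P)
    (hPρ : measPVM κ P ρ = ∑ k, ((prior p k : ℝ) : ℂ) • (Ω k ⊗ₖ ketBra (κ k))) (m : ℕ) :
    ∃ σ : Op ix ((Sys.comp A K).copies m), IsState σ ∧
      M _ σ ≤ M B η + m * (M A ρ + L) ∧
      traceNorm (tensorPow ix (S := .comp A K) (measPVM κ P ρ) m - σ) ≤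
        m * (4 * √(pFail p (fun k => Λ (Ω k)) Q)) := by
  set V : Op ix (.comp A B) := (U : Op ix (.comp A B)) with hV
  have hUU : V.conjTranspose * V = 1 := Matrix.UnitaryGroup.star_mul_self U
  have hUU' : V * V.conjTranspose = 1 := Matrix.mem_unitaryGroup_iff.1 U.2
  set F : Fin 2 → Op ix (.comp A B) := fun k => effKraus e V (CFC.sqrt (Q k)) with hFdef
  have hFpos : ∀ k, (F k).PosSemidef := fun k => posSemidef_effKraus e V (sqrt_posSemidef _)
  have hF : ∀ k, (F k).IsHermitian := fun k => (hFpos k).isHermitian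
  have hF2 : ∀ k, F k * F k = effKraus e V (Q k) := fun k => by
    rw [hFdef]
    exact (effKraus_mul e hUU' _ _).trans (by rw [sqrt_mul_sqrt (hQ.1 k)])
  have hone : ∀ X, 1 - effKraus e V X = effKraus e V (1 - X) := fun X => by
    rw [effKraus_sub]
    congr 1
    exact (effKraus_one e hUU).symm
  have hF1 : ∀ k, (1 - F k).PosSemidef := fun k => by
    rw [hFdef]
    dsimp only
    rw [hone]
    exact posSemidef_effKraus e V (one_sub_sqrt_povm hQ k)
  have hFF : ∑ k, F k * F k = 1 := by
    simp only [hF2]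
    rw [Fin.sum_univ_two]
    have h0 : Q 0 = 1 - Q 1 := by
      rw [← hQ.2, Fin.sum_univ_two]; abel
    rw [h0, ← hone]
    abel
  have hPP : IsPVM fun k => P k ⊗ₖ (1 : Op ix B) := by
    refine ⟨fun k => ⟨?_, ?_⟩, ?_⟩
    · rw [Matrix.IsHermitian, Matrix.conjTranspose_kronecker, Matrix.conjTranspose_one,
        (hP.1 k).1.eq]
    · rw [← Matrix.mul_kronecker_mul, (hP.1 k).2, one_mul]
    · have h := hP.2
      rw [Fin.sum_univ_two] at h ⊢
      rw [← Matrix.add_kronecker, h, Matrix.one_kronecker_one]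
  have hblock : ∀ k, P k * ρ * P k = ((prior p k : ℝ) : ℂ) • Ω k := fun k => by
    refine sum_kronecker_ketBra_injective κ (X := fun k => P k * ρ * P k)
      (Y := fun k => ((prior p k : ℝ) : ℂ) • Ω k) ?_ k
    simp only [Matrix.smul_kronecker]
    exact hPρ
  -- The disturbance parameter is exactly the failure probability: P_kρP_k = p_kρ_k, and 1 − F_k² is
  -- the effective operator of 1 − Q_k, whose statistics on ρ_k ⊗ η are those of 1 − Q_k on Λ(ρ_k).
  have hq : pFail p (fun k => Λ (Ω k)) Q = ∑ k, ((1 - F k * F k) *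
      ((P k ⊗ₖ (1 : Op ix B)) * (ρ ⊗ₖ η) * (P k ⊗ₖ (1 : Op ix B)))).trace.re := by
    refine Finset.sum_congr rfl fun k _ => ?_
    dsimp only
    rw [hF2, hone, ← Matrix.mul_kronecker_mul, ← Matrix.mul_kronecker_mul, hblock, one_mul, mul_one,
      Matrix.smul_kronecker, Matrix.mul_smul, Matrix.trace_smul, smul_eq_mul, Complex.re_ofReal_mul,
      himp.eq_of_zero hΛ (posTP_implemented e U hη) (hΩ k)]
    congr 2
    exact (trace_effKraus_mul e V (1 - Q k) (Ω k ⊗ₖ η)).symm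
  have hstate := isState_reuseState κ hF hFF hρ hη
  refine ⟨partialTrace (reuseState κ F ρ η m), posTP_partialTrace.isState (hstate m), ?_, ?_⟩
  · have hcost : ∀ m : ℕ, M _ (reuseState κ F ρ η m) ≤ M B η + m * (M A ρ + L) := by
      intro m
      induction m with
      | zero =>
        have h1 := hM.additive .one B (1 : Matrix Unit Unit ℂ) η isState_one hη
        rw [resource_one hM, zero_add] at h1
        rw [Nat.cast_zero, zero_mul, add_zero]
        exact h1.le
      | succ m ih =>
        have h1 := resource_reuse_le hM he hU κ hQ hL ((Sys.comp A K).copies m) hρ (hstate m)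
        refine h1.trans ?_
        push_cast
        linarith
    exact (hM.monotone _ _ _ (.trace _ B) _ (hstate m)).trans (hcost m)
  -- The disturbance bound is available only for t strictly above 4√P_fail; the endpoint follows by
  -- letting t decrease to it.
  · have hbound : ∀ t, 4 * √(pFail p (fun k => Λ (Ω k)) Q) < t →
        traceNorm (tensorPow ix (S := .comp A K) (measPVM κ P ρ) m -
          partialTrace (reuseState κ F ρ η m)) ≤ m * t := by
      intro t ht
      have h0 := diffBound_measure_sub κ (isState_kronecker hρ hη) hFpos hF1 hFF hPP hq
        (pFail_nonneg hQ hp fun k => hΛ.isState (hΩ k)) ht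
      have h1 := diffBound_reuseState κ hF hFF hρ hP h0 m
      have h2 := (posTP_partialTrace.diffBound h1).neg
      rw [posTP_partialTrace.map_sub, partialTrace_kronecker hη, neg_sub] at h2
      exact h2.traceNorm_le
    have hlim : Filter.Tendsto (fun t : ℝ => (m : ℝ) * t)
        (𝓝[>] (4 * √(pFail p (fun k => Λ (Ω k)) Q)))
        (𝓝 (m * (4 * √(pFail p (fun k => Λ (Ω k)) Q)))) :=
      (tendsto_const_nhds.mul Filter.tendsto_id).mono_left nhdsWithin_le_nhds
    exact ge_of_tendsto hlim (eventually_nhdsWithin_of_forall hbound)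

end Systems

end

/-! ### Choosing the number of rounds -/

section Optimization

/-- If D were 0, all multiples of β would stay below w. So for α > 0 the denominators of the first
two bounds can vanish only if no implementation exists. -/
lemma pos_of_forall_nat_mul_le {β w D : ℝ} {φ : ℕ → ℝ} (hβ : 0 < β) (hD : 0 ≤ D)
    (h : ∀ m : ℕ, 1 ≤ m → m * β ≤ w + φ m * D) : 0 < D := by
  refine hD.lt_of_ne fun h0 => ?_
  obtain ⟨m, hm⟩ := exists_nat_gt (w / β)
  have h1 := h (m + 1) (by omega)
  rw [← h0, mul_zero, add_zero] at h1
  rw [div_lt_iff₀ hβ] at hm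
  push_cast at h1
  linarith

/-- The function mβ − m^s D is maximal at x = (β/(sD))^{1/(s−1)}, where x^s D = βx/s and the value
is βx(1 − 1/s). Rounding x down loses at most β in the linear term and does not increase the other.
-/
lemma le_of_forall_nat_rpow {β w D s : ℝ} (hβ : 0 < β) (hD : 0 < D) (hs : 1 < s) (hw : 0 ≤ w)
    (h : ∀ m : ℕ, 1 ≤ m → m * β ≤ w + (m : ℝ) ^ s * D) :
    (1 / s) ^ (1 / (s - 1)) * (1 - 1 / s) * β ^ (s / (s - 1)) / D ^ (1 / (s - 1)) - β ≤ w := by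
  have hs0 : 0 < s := by linarith
  have hs1 : 0 < s - 1 := by linarith
  set x := (β / (s * D)) ^ (1 / (s - 1)) with hx
  have hx0 : 0 < x := by positivity
  have hxs : x ^ s = x * (β / (s * D)) := by
    have : s = 1 + (s - 1) := by ring
    rw [this, Real.rpow_add hx0, Real.rpow_one, ← this]
    congr 1
    rw [hx, ← Real.rpow_mul (by positivity), one_div_mul_cancel hs1.ne', Real.rpow_one]
  have hmain : (1 / s) ^ (1 / (s - 1)) * (1 - 1 / s) * β ^ (s / (s - 1)) / D ^ (1 / (s - 1))
      = β * x * (1 - 1 / s) := by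
    have h1 : s / (s - 1) = 1 + 1 / (s - 1) := by field_simp; ring
    have h2 : β / (s * D) = (1 / s) * β / D := by field_simp
    rw [hx, h1, Real.rpow_add hβ, Real.rpow_one, h2, Real.div_rpow (by positivity) hD.le,
      Real.mul_rpow (by positivity) hβ.le]
    ring
  rw [hmain]
  have hfrac : 0 < 1 / s := by positivity
  -- For x < 1 the floor is 0, which is not an admissible m, but then the left side is at most 0.
  rcases lt_or_ge x 1 with hx1 | hx1
  · have : β * x * (1 - 1 / s) ≤ β * 1 * 1 := by
      have : 1 / s < 1 := by rw [div_lt_one hs0]; exact hs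
      gcongr
      linarith
    linarith
  · have hm1 : 1 ≤ ⌊x⌋₊ := Nat.one_le_floor_iff x |>.2 hx1
    have h1 := h _ hm1
    have h2 : (⌊x⌋₊ : ℝ) ≤ x := Nat.floor_le hx0.le
    have h3 : x - 1 < ⌊x⌋₊ := Nat.sub_one_lt_floor x
    have h4 : (⌊x⌋₊ : ℝ) ^ s * D ≤ x ^ s * D := by gcongr
    have h5 : x ^ s * D = β * x * (1 / s) := by rw [hxs]; field_simp
    have h6 := mul_lt_mul_of_pos_right h3 hβ
    nlinarith

/-- The maximizer x of mβ − e^{tm}D satisfies e^{tx}D = β/t, which accounts for the loss β/t; the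
further loss β comes from rounding down. -/
lemma le_of_forall_nat_exp {β w D t : ℝ} (hβ : 0 < β) (hD : 0 < D) (ht : 0 < t) (hw : 0 ≤ w)
    (h : ∀ m : ℕ, 1 ≤ m → m * β ≤ w + Real.exp (t * m) * D) :
    β / t * Real.log (β / (D * t)) - β * (1 + 1 / t) ≤ w := by
  set x := Real.log (β / (D * t)) / t with hx
  have hexp : Real.exp (t * x) = β / (D * t) := by
    rw [hx, mul_div_cancel₀ _ ht.ne', Real.exp_log (by positivity)]
  have hmain : β / t * Real.log (β / (D * t)) - β * (1 + 1 / t) = β * x - β - β / t := by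
    rw [hx]; field_simp; ring
  rw [hmain]
  have hβt : 0 < β / t := by positivity
  rcases lt_or_ge x 1 with hx1 | hx1
  · nlinarith
  · have h1 := h _ (Nat.one_le_floor_iff x |>.2 hx1)
    have h2 : (⌊x⌋₊ : ℝ) ≤ x := Nat.floor_le (by linarith)
    have h3 : x - 1 < ⌊x⌋₊ := Nat.sub_one_lt_floor x
    have h4 : Real.exp (t * ⌊x⌋₊) * D ≤ Real.exp (t * x) * D := by gcongr
    have h5 : Real.exp (t * x) * D = β / t := by rw [hexp]; field_simp
    nlinarith

/-- The power bound with s = 2 gives β²/(4C f(x)) − β, and 1/(4f(x)) ≥ 1/(16x) − 1/64 because (4 −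
x)(4 + x) ≤ 16. -/
lemma le_of_forall_nat_sq {β w C x : ℝ} (hβ : 0 < β) (hC : 0 < C) (hx : 0 < x) (hw : 0 ≤ w)
    (h : ∀ m : ℕ, 1 ≤ m → m * β ≤ w + (m : ℝ) ^ (1 + 1 : ℝ) * (C * fErr x)) :
    β ^ 2 / (16 * C * x) - (β + β ^ 2 / (64 * C)) ≤ w := by
  have hf : 0 < fErr x := by unfold fErr; positivity
  have h0 := le_of_forall_nat_rpow hβ (mul_pos hC hf) (by norm_num) hw h
  norm_num at h0
  have h1 : β ^ 2 / (16 * C * x) - β ^ 2 / (64 * C) ≤ 1 / 4 * β ^ 2 / (C * fErr x) := by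
    have e : β ^ 2 / (16 * C * x) - β ^ 2 / (64 * C) = β ^ 2 / C * ((4 - x) / (64 * x)) := by
      field_simp
      ring
    have e' : 1 / 4 * β ^ 2 / (C * fErr x) = β ^ 2 / C * (1 / (4 * fErr x)) := by
      field_simp
    rw [e, e']
    refine mul_le_mul_of_nonneg_left ?_ (by positivity)
    rw [div_le_div_iff₀ (by positivity) (by positivity), fErr]
    nlinarith [pow_pos hx 3]
  linarith

end Optimization

/-! ### The trade-off between α, the ancilla and the number of rounds -/

section Core

variable {E : Type u} {ix : E → Type} [∀ e, Fintype (ix e)] [∀ e, DecidableEq (ix e)]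
variable {T : ResourceTheory ix} {M : StateFunction ix} {c : ℝ → ℝ} {cmax : ℝ}

lemma fErr_nonneg {x : ℝ} (hx : 0 ≤ x) : 0 ≤ fErr x := by unfold fErr; positivity

lemma HolderFinite.bound_of_le (hM : IsResourceMeasure T M c cmax) {S : Sys E} {C a b : ℝ}
    (h : HolderFinite M c S C a b) {ρ : Op ix S} (hρ : IsState ρ) {m : ℕ} (hm : 1 ≤ m)
    {σ : Op ix (S.copies m)} (hσ : IsState σ) {x : ℝ}
    (hx : traceNorm (tensorPow ix ρ m - σ) ≤ m * x) (hx0 : 0 ≤ x) :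
    M (S.copies m) (tensorPow ix ρ m) - M (S.copies m) σ ≤
      cmax + (m : ℝ) ^ (a + b) * (C * x ^ b) := by
  have hm0 : (0 : ℝ) < m := by exact_mod_cast hm
  have h1 := (le_abs_self _).trans (h.bound m hm ρ hρ σ hσ)
  have h2 := hM.c_le _ (traceNorm_nonneg (tensorPow ix ρ m - σ))
  have h3 : traceNorm (tensorPow ix ρ m - σ) ^ b ≤ (m * x) ^ b :=
    Real.rpow_le_rpow (traceNorm_nonneg _) hx h.b_pos.le
  have h4 := mul_le_mul_of_nonneg_left h3
    (mul_nonneg (Real.rpow_nonneg hm0.le a) h.κ_nonneg)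
  have h5 : (m : ℝ) ^ a * C * (m * x) ^ b = (m : ℝ) ^ (a + b) * (C * x ^ b) := by
    rw [Real.mul_rpow hm0.le hx0, Real.rpow_add hm0]; ring
  linarith

/-- The linear growth of the error is absorbed by m ≤ e^m, which adds b to the exponent a'. -/
lemma HolderInfinite.bound_of_le (hM : IsResourceMeasure T M c cmax) {S : Sys E} {C a' b : ℝ}
    (h : HolderInfinite M c S C a' b) {ρ : Op ix S} (hρ : IsState ρ) {m : ℕ} (hm : 1 ≤ m)
    {σ : Op ix (S.copies m)} (hσ : IsState σ) {x : ℝ}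
    (hx : traceNorm (tensorPow ix ρ m - σ) ≤ m * x) (hx0 : 0 ≤ x) :
    M (S.copies m) (tensorPow ix ρ m) - M (S.copies m) σ ≤
      cmax + Real.exp ((a' + b) * m) * (C * x ^ b) := by
  have hm0 : (0 : ℝ) < m := by exact_mod_cast hm
  have h1 := (le_abs_self _).trans (h.bound m hm ρ hρ σ hσ)
  have h2 := hM.c_le _ (traceNorm_nonneg (tensorPow ix ρ m - σ))
  have hme : (m : ℝ) ≤ Real.exp m := by linarith [Real.add_one_le_exp (m : ℝ)]
  have h3 : traceNorm (tensorPow ix ρ m - σ) ^ b ≤ (Real.exp m * x) ^ b :=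
    Real.rpow_le_rpow (traceNorm_nonneg _)
      (hx.trans (mul_le_mul_of_nonneg_right hme hx0)) h.b_pos.le
  have h4 := mul_le_mul_of_nonneg_left h3 (mul_nonneg (Real.exp_pos (a' * m)).le h.κ_nonneg)
  have h5 : Real.exp (a' * m) * C * (Real.exp m * x) ^ b =
      Real.exp ((a' + b) * m) * (C * x ^ b) := by
    rw [Real.mul_rpow (Real.exp_pos _).le hx0, ← Real.exp_mul, add_mul, Real.exp_add]
    ring_nf
  linarith

/-- The trade-off for `m` uses of an exact implementation with ancilla `η`. -/
lemma exists_alpha_le (hM : IsResourceMeasure T M c cmax) {A A' B B' K : Sys E}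
    {Λ : Op ix A →ₗ[ℂ] Op ix A'} (hΛ : IsChannel Λ)
    {e : (Sys.comp A B).idx ix ≃ (Sys.comp A' B').idx ix}
    (he : Regroup ix (.comp A B) (.comp A' B') e)
    {U : Matrix.unitaryGroup ((Sys.comp A B).idx ix) ℂ} (hU : U ∈ T.freeUnitaries (.comp A B))
    {η : Op ix B} (hη : IsState η) (himp : ChannelClose 0 Λ (implemented e U η))
    (κ : OrthonormalBasis (Fin 2) ℂ (EuclideanSpace ℂ (K.idx ix)))
    {p : ℝ} (hp : p ∈ Set.Icc (0 : ℝ) 1)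
    {Ω : Fin 2 → Op ix A} (hΩ : ∀ k, IsState (Ω k))
    {Q : Fin 2 → Op ix A'} (hQ : IsPOVM Q) {α : ℝ≥0∞}
    (hα : α = (emGain M κ p Ω -
      power M (S := A') (S' := .comp A' K) (measPOVM κ Q)).toENNReal)
    {pf : ℝ} (hpf : pf = pFail p (fun k => Λ (Ω k)) Q) :
    ∃ β : ℝ, 0 ≤ β ∧ α = ENNReal.ofReal β ∧
      (∀ C a b, HolderFinite M c (.comp A K) C a b → ∀ m : ℕ, 1 ≤ m →
        m * β ≤ M B η + cmax + (m : ℝ) ^ (a + b) * (C * fErr (√pf) ^ b)) ∧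
      ∀ C a' b, HolderInfinite M c (.comp A K) C a' b → ∀ m : ℕ, 1 ≤ m →
        m * β ≤ M B η + cmax + Real.exp ((a' + b) * m) * (C * fErr (√pf) ^ b) := by
  have hv := resource_nonneg hM hη
  have hc := cmax_nonneg hM
  have hf : 0 ≤ fErr (√pf) := fErr_nonneg (Real.sqrt_nonneg _)
  have hnnf : ∀ C a b, HolderFinite M c (.comp A K) C a b → ∀ m : ℕ,
      0 ≤ cmax + (m : ℝ) ^ (a + b) * (C * fErr (√pf) ^ b) := fun C a b h m => by
    have := h.κ_nonneg
    positivity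
  have hnni : ∀ C a' b, HolderInfinite M c (.comp A K) C a' b → ∀ m : ℕ,
      0 ≤ cmax + Real.exp ((a' + b) * m) * (C * fErr (√pf) ^ b) := fun C a' b h m => by
    have := h.κ_nonneg
    positivity
  set w := power M (S := A') (S' := .comp A' K) (measPOVM κ Q) with hw
  have hgain : ∀ (R : Sys E) (σ : Op ix (.comp R A')), IsState σ →
      ((gain M (S := .comp R A') (S' := .comp R (.comp A' K))
        (idTensor (R.idx ix) (measPOVM κ Q)) σ : ℝ) : EReal) ≤ w :=
    fun R σ hσ => le_sSup ⟨R, σ, hσ, rfl⟩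
  -- The product of Λ(ρ₁) with a trivial reference already contributes a real number to the
  -- supremum.
  have hbot : w ≠ ⊥ := by
    have h1 := hgain .one (Matrix.kroneckerMap (· * ·) (1 : Matrix Unit Unit ℂ) (Λ (Ω 0)))
      (isState_kronecker isState_one (hΛ.isState (hΩ 0)))
    exact ((EReal.bot_lt_coe _).trans_le h1).ne'
  -- An infinite power of Λ_Q makes α = 0, and the inequalities are trivial with β = 0.
  by_cases htop : w = ⊤
  · refine ⟨0, le_rfl, ?_, fun C a b h m _ => ?_, fun C a' b h m _ => ?_⟩
    · rw [hα, htop, EReal.sub_top]; simp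
    · rw [mul_zero]; linarith [hnnf C a b h m]
    · rw [mul_zero]; linarith [hnni C a' b h m]
  · obtain ⟨L, hL⟩ : ∃ L : ℝ, w = L := ⟨w.toReal, (EReal.coe_toReal htop hbot).symm⟩
    have hL' : ∀ (R : Sys E) (σ : Op ix (.comp R A')), IsState σ →
        gain M (S := .comp R A') (S' := .comp R (.comp A' K))
          (idTensor (R.idx ix) (measPOVM κ Q)) σ ≤ L := fun R σ hσ => by
      have := hgain R σ hσ
      rw [hL] at this
      exact_mod_cast this
    -- V stands for either continuity bound. The gain is bounded for each ρ and P separately, so the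
    -- supremum need not be attained.
    have key : ∀ (m : ℕ) (V : ℝ), 1 ≤ m →
        (∀ (ρ : Op ix (.comp A K)) (σ : Op ix ((Sys.comp A K).copies m)), IsState ρ → IsState σ →
          traceNorm (tensorPow ix ρ m - σ) ≤ m * fErr (√pf) →
          M _ (tensorPow ix ρ m) - M _ σ ≤ V) →
        α ≤ ENNReal.ofReal ((M B η + V) / m) := by
      intro m V hm hV
      have hm0 : (0 : ℝ) < m := by exact_mod_cast hm
      have hem : emGain M κ p Ω ≤ (((M B η + V) / m : ℝ) : EReal) + w := by
        rw [hL, ← EReal.coe_add]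
        refine sSup_le ?_
        rintro x ⟨ρ, P, hρ, hP, -, hPρ, rfl⟩
        have hρ' : IsState (measPVM κ P ρ) := (posTP_measure κ (fun k => (hP.1 k).1)
          (by simp only [(hP.1 _).2, hP.2])).isState hρ
        obtain ⟨σ, hσ, h1, h2⟩ := exists_approx_copies κ hM hΛ he hU hη himp hp hΩ hQ hL' hρ hP
          hPρ m
        have h3 : traceNorm (tensorPow ix (S := .comp A K) (measPVM κ P ρ) m - σ) ≤
            m * fErr (√pf) := by
          refine h2.trans (mul_le_mul_of_nonneg_left ?_ hm0.le)
          rw [← hpf, fErr]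
          linarith [sq_nonneg (√pf)]
        have h4 := hV _ σ hρ' hσ h3
        rw [resource_tensorPow hM (S := .comp A K) hρ'] at h4
        rw [EReal.coe_le_coe_iff, gain, ← sub_le_iff_le_add, le_div_iff₀ hm0]
        linarith
      rw [hα, ← EReal.real_coe_toENNReal]
      exact EReal.toENNReal_le_toENNReal (EReal.sub_le_of_le_add hem)
    have hfin : ∀ C a b, HolderFinite M c (.comp A K) C a b → ∀ m : ℕ, 1 ≤ m →
        α ≤ ENNReal.ofReal ((M B η + (cmax + (m : ℝ) ^ (a + b) * (C * fErr (√pf) ^ b))) / m) :=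
      fun C a b h m hm => key m _ hm fun ρ σ hρ hσ hx => h.bound_of_le hM hρ hm hσ hx hf
    have hinf : ∀ C a' b, HolderInfinite M c (.comp A K) C a' b → ∀ m : ℕ, 1 ≤ m →
        α ≤ ENNReal.ofReal
          ((M B η + (cmax + Real.exp ((a' + b) * m) * (C * fErr (√pf) ^ b))) / m) :=
      fun C a' b h m hm => key m _ hm fun ρ σ hρ hσ hx => h.bound_of_le hM hρ hm hσ hx hf
    -- Continuity with m = 1 already bounds α by a real number.
    have hαtop : α ≠ ⊤ := by
      rcases hM.holder (.comp A K) with ⟨C, a, b, h⟩ | ⟨C, a', b, h⟩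
      · exact ((hfin C a b h 1 le_rfl).trans_lt ENNReal.ofReal_lt_top).ne
      · exact ((hinf C a' b h 1 le_rfl).trans_lt ENNReal.ofReal_lt_top).ne
    have hreal : ∀ (m : ℕ) (V : ℝ), 1 ≤ m → 0 ≤ V → α ≤ ENNReal.ofReal ((M B η + V) / m) →
        m * α.toReal ≤ M B η + V := by
      intro m V hm hV h
      have hm0 : (0 : ℝ) < m := by exact_mod_cast hm
      have := ENNReal.toReal_le_of_le_ofReal (by positivity) h
      rw [le_div_iff₀ hm0] at this
      linarith
    refine ⟨α.toReal, ENNReal.toReal_nonneg, (ENNReal.ofReal_toReal hαtop).symm,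
      fun C a b h m hm => ?_, fun C a' b h m hm => ?_⟩
    · rw [add_assoc]
      exact hreal m _ hm (hnnf C a b h m) (hfin C a b h m hm)
    · rw [add_assoc]
      exact hreal m _ hm (hnni C a' b h m) (hinf C a' b h m hm)

end Core

end QRT

/-! ### The three bounds in extended real arithmetic -/

theorem theorem2 {E : Type u} (ix : E → Type) [∀ e, Fintype (ix e)] [∀ e, DecidableEq (ix e)]
    -- a resource theory with a resource measure satisfying (i)-(iii)
    (T : ResourceTheory ix) (M : StateFunction ix) (c : ℝ → ℝ) (cmax : ℝ)
    (hM : IsResourceMeasure T M c cmax)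
    -- systems, a channel from `A` to `A'`, and a two-level register
    (A A' K : Sys E)
    (Λ : Op ix A →ₗ[ℂ] Op ix A') (hΛ : IsChannel Λ)
    (κ : OrthonormalBasis (Fin 2) ℂ (EuclideanSpace ℂ (K.idx ix)))
    -- a test ensemble of two orthogonal states on `A`
    (p : ℝ) (hp : p ∈ Set.Icc (0 : ℝ) 1)
    (Ω : Fin 2 → Op ix A) (hΩ : ∀ k, IsState (Ω k)) (horth : fidelity (Ω 0) (Ω 1) = 0)
    -- a two-valued POVM on `A'`
    (Q : Fin 2 → Op ix A') (hQ : IsPOVM Q)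
    -- `α = |M_em(Ω_p | 𝒦) - M(Λ_Q)|₊` and `pf = P_fail(Ω'_{p,Λ}, Q)`
    (α : ℝ≥0∞)
    (hα : α = (emGain M κ p Ω -
      power M (S := A') (S' := .comp A' K) (measPOVM κ Q)).toENNReal)
    (pf : ℝ) (hpf : pf = pFail p (fun k => Λ (Ω k)) Q) :
    -- finite exponent `a`
    (∀ C a b : ℝ, HolderFinite M c (.comp A K) C a b →
      ((ENNReal.ofReal (gConst a b) * α ^ ((a + b) / (a + b - 1)) /
          ENNReal.ofReal (C * fErr (Real.sqrt pf) ^ b) ^ (1 / (a + b - 1)) : ℝ≥0∞) : EReal)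
        - (α : EReal) - (cmax : EReal) ≤ cost T M 0 Λ) ∧
    -- `a = ∞`
    (∀ C a' b : ℝ, HolderInfinite M c (.comp A K) C a' b → 0 < a' + b →
      ((α / ENNReal.ofReal (a' + b) : ℝ≥0∞) : EReal) *
          ENNReal.log (α / ENNReal.ofReal (C * fErr (Real.sqrt pf) ^ b * (a' + b)))
        - ((α * ENNReal.ofReal (1 + 1 / (a' + b)) : ℝ≥0∞) : EReal) - (cmax : EReal)
        ≤ cost T M 0 Λ) ∧
    -- the case `a = b = 1`
    (∀ C : ℝ, HolderFinite M c (.comp A K) C 1 1 →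
      ((α ^ 2 / ENNReal.ofReal (16 * C * Real.sqrt pf) : ℝ≥0∞) : EReal)
        - ((cmax : EReal) + (α : EReal) + ((α ^ 2 / ENNReal.ofReal (64 * C) : ℝ≥0∞) : EReal))
        ≤ cost T M 0 Λ) := by

  have hf : 0 ≤ fErr (√pf) := fErr_nonneg (Real.sqrt_nonneg _)
  have hcm := cmax_nonneg hM
  -- The cost is an infimum, so one implementation is fixed in each case. For α = 0 the leading
  -- terms vanish by convention and M(η) ≥ 0 suffices; for α > 0 everything becomes real.
  refine ⟨fun C a b h => ?_, fun C a' b h ht => ?_, fun C h => ?_⟩ <;>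
    refine le_sInf ?_ <;> rintro x ⟨B, B', e, U, η, he, hU, hη, himp, rfl⟩ <;>
    obtain ⟨β, hβ0, rfl, hfin, hinf⟩ :=
      exists_alpha_le hM hΛ he hU hη himp κ hp hΩ hQ hα hpf <;>
    clear hα <;>
    have hv := resource_nonneg hM hη <;>
    rcases hβ0.eq_or_lt with rfl | hβ
  · have hs : 0 < (a + b) / (a + b - 1) := div_pos (by linarith [h.one_lt]) (by linarith [h.one_lt])
    simp only [ENNReal.ofReal_zero, ENNReal.zero_rpow_of_pos hs, mul_zero, ENNReal.zero_div,
      EReal.coe_ennreal_zero]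
    rw [← EReal.coe_zero, ← EReal.coe_sub, ← EReal.coe_sub, EReal.coe_le_coe_iff]
    linarith
  · have hs := h.one_lt
    have hD := pos_of_forall_nat_mul_le (φ := fun m : ℕ => (m : ℝ) ^ (a + b)) hβ
      (mul_nonneg h.κ_nonneg (Real.rpow_nonneg hf b)) (hfin C a b h)
    have h1 := le_of_forall_nat_rpow hβ hD hs (by linarith) (hfin C a b h)
    have hg : 0 ≤ gConst a b := by
      have : 1 / (a + b) < 1 := by rw [div_lt_one (by linarith)]; exact hs
      exact mul_nonneg (Real.rpow_nonneg (by positivity) _) (by linarith)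
    rw [ENNReal.ofReal_rpow_of_pos hβ, ENNReal.ofReal_rpow_of_pos hD, ← ENNReal.ofReal_mul hg,
      ← ENNReal.ofReal_div_of_pos (Real.rpow_pos_of_pos hD _), EReal.coe_ennreal_ofReal,
      EReal.coe_ennreal_ofReal, max_eq_left hβ.le, max_eq_left (by positivity), ← EReal.coe_sub,
      ← EReal.coe_sub, EReal.coe_le_coe_iff, gConst]
    linarith
  · simp only [ENNReal.ofReal_zero, ENNReal.zero_div, zero_mul, EReal.coe_ennreal_zero]
    rw [← EReal.coe_zero, ← EReal.coe_sub, ← EReal.coe_sub, EReal.coe_le_coe_iff]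
    linarith
  · have hD := pos_of_forall_nat_mul_le (φ := fun m : ℕ => Real.exp ((a' + b) * m)) hβ
      (mul_nonneg h.κ_nonneg (Real.rpow_nonneg hf b)) (hinf C a' b h)
    have h1 := le_of_forall_nat_exp hβ hD ht (by linarith) (hinf C a' b h)
    rw [← ENNReal.ofReal_div_of_pos ht, ← ENNReal.ofReal_div_of_pos (mul_pos hD ht),
      ENNReal.log_ofReal_of_pos (by positivity), ← ENNReal.ofReal_mul hβ.le,
      EReal.coe_ennreal_ofReal, EReal.coe_ennreal_ofReal, max_eq_left (by positivity),
      max_eq_left (by positivity), ← EReal.coe_mul, ← EReal.coe_sub, ← EReal.coe_sub,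
      EReal.coe_le_coe_iff]
    linarith
  · simp only [ENNReal.ofReal_zero, ne_eq, OfNat.ofNat_ne_zero, not_false_eq_true, zero_pow,
      ENNReal.zero_div, EReal.coe_ennreal_zero]
    norm_cast
    linarith
  -- For K = 0 the correction c₂' is infinite, so the left side is `⊥`.
  · rcases h.κ_nonneg.eq_or_lt with rfl | hC
    · have : (ENNReal.ofReal β) ^ 2 / ENNReal.ofReal (64 * 0) = ⊤ := by
        rw [mul_zero, ENNReal.ofReal_zero, ENNReal.div_zero]
        exact pow_ne_zero _ (ENNReal.ofReal_pos.2 hβ).ne'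
      rw [this, EReal.coe_ennreal_top, EReal.add_top_of_ne_bot, EReal.sub_top]
      · exact bot_le
      · rw [EReal.coe_ennreal_ofReal, ← EReal.coe_add]
        exact EReal.coe_ne_bot _
    · have h0 := hfin C 1 1 h
      simp only [Real.rpow_one] at h0
      have hD := pos_of_forall_nat_mul_le (φ := fun m : ℕ => (m : ℝ) ^ (1 + 1 : ℝ)) hβ
        (mul_nonneg hC.le hf) h0
      have hx : 0 < √pf := (Real.sqrt_nonneg _).lt_of_ne fun h' => by
        rw [← h'] at hD
        simp [fErr] at hD
      have h1 := le_of_forall_nat_sq hβ hC hx (by linarith) h0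
      rw [← ENNReal.ofReal_pow hβ.le, ← ENNReal.ofReal_div_of_pos (by positivity),
        ← ENNReal.ofReal_div_of_pos (by positivity), EReal.coe_ennreal_ofReal,
        EReal.coe_ennreal_ofReal, EReal.coe_ennreal_ofReal, max_eq_left hβ.le,
        max_eq_left (by positivity), max_eq_left (by positivity), ← EReal.coe_add,
        ← EReal.coe_add, ← EReal.coe_sub, EReal.coe_le_coe_iff]
      linarith
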